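/- Let $(X,d)$ be a complete metric space, $u^*\in X$, and let $\phi_\varepsilon\colon X\to(-\infty,+\infty]$ ($\varepsilon>0$) and $\phi\colon X\to(-\infty,+\infty]$. The (descending) slope of $\psi\colon X\to(-\infty,+\infty]$ is $|\partial\psi|(x)=\limsup_{y\to x}\frac{(\psi(x)-\psi(y))^+}{d(x,y)}$ if $\psi(x)<+\infty$ and $x$ is not isolated, $|\partial\psi|(x)=0$ if $\psi(x)<+\infty$ and $x$ is isolated, and $|\partial\psi|(x)=+\infty$ if $\psi(x)=+\infty$. Assume: (i) $\phi_\varepsilon$ is lower semicontinuous for every $\varepsilon>0$; (ii) there exist $C^*\in\mathbb R$ and $\tau^*>0$ such that $\inf_{v\in X}\bigl\{\phi_\varepsilon(v)+\frac1{2\tau^*}d^2(v,u^*)\bigr\}\ge C^*$ for all $\varepsilon>0$; (iii) for every $C>0$ there is a compact set $K\subset X$ such that $\{u: d^2(u,u^*)\le C,\ |\phi_\varepsilon(u)|\le C\}\subset K$ for all $\varepsilon>0$; (H) for all sequences $\varepsilon_n\to0^+$ and $v_n\to v$ in $X$ with $\sup_n\{|\phi_{\varepsilon_n}(v_n)|+|\partial\phi_{\varepsilon_n}|(v_n)\}<+\infty$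 one has $\lim_n\phi_{\varepsilon_n}(v_n)=\phi(v)$ and $\liminf_n|\partial\phi_{\varepsilon_n}|(v_n)\ge|\partial\phi|(v)$. Let $u^0_{\varepsilon,\tau}\in X$ ($\varepsilon,\tau>0$) satisfy $d^2(u^0_{\varepsilon,\tau},u^*)\le S'$ and $|\phi_\varepsilon(u^0_{\varepsilon,\tau})|\le S$ for some constants $S',S<+\infty$ independent of $\varepsilon,\tau$, and let $\tau_\varepsilon>0$ be any family with $\tau_\varepsilon\to0$ as $\varepsilon\to0^+$. Let $u\colon[0,+\infty)\to X$ be any minimizing movement along $\phi_\varepsilon$ at scale $\tau_\varepsilon$ with initial data $u^0_{\varepsilon,\tau_\varepsilon}$; that is, for small $\varepsilon$ there are sequences $(u^i_\varepsilon)_{i\ge0}$ with $u_\varepsilon^0=u^0_{\varepsilon,\tau_\varepsilon}$ and $u^{i+1}_\varepsilon$ a minimizer over $v\in X$ of $\phi_\varepsilon(v)+\frac1{2\tau_\varepsilon}d^2(v,u^i_\varepsilon)$, and there is a sequence $\varepsilon_n\to0^+$ such that $\overline u_{\varepsilon_n}(t)\to u(t)$ for every $t\ge0$, where $\overline u_\varepsilon(0)=u^0_\varepsilon$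 and $\overline u_\varepsilon(t)=u_\varepsilon^{i+1}$ for $t\in(i\tau_\varepsilon,(i+1)\tau_\varepsilon]$. Then, for every $T>0$, $u$ is a curve of maximal slope for $\phi$ in $[0,T]$; that is: - $u\in AC^2([0,T];X)$, meaning that there is $A\in L^2(0,T)$ with $d(u(s),u(t))\le\int_s^tA(r)\,dr$ for all $0\le s\le t\le T$; the a.e. smallest such $A$ exists and is denoted by $|u'|$; - $r\mapsto|\partial\phi|(u(r))$ is Lebesgue measurable on $[0,T]$, and there is a non-increasing function $\varphi\colon[0,T]\to\mathbb R$ such that $\varphi(t)=\phi(u(t))$ for a.e. $t\in[0,T]$ and $$\varphi(s)-\varphi(t)\ge\frac12\int_s^t|u'|^2(r)\,dr+\frac12\int_s^t|\partial\phi|^2(u(r))\,dr\qquad\text{for all }0\le s\le t\le T.$$ -/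

import Mathlib

open Set Filter Topology MeasureTheory
open scoped ENNReal

noncomputable section

/-- Descending slope `|∂φ|(x)` of `φ : X → (-∞, +∞]`. If `x` is isolated then `𝓝[≠] x = ⊥` and the
`limsup` (taken in `[0, +∞]`) is `0`. `EReal.toENNReal` is the positive part. -/
def descendingSlope {X : Type*} [MetricSpace X] (φ : X → EReal) (x : X) : ℝ≥0∞ :=
  open Classical in
  if φ x = ⊤ then ⊤
  else limsup (fun y => (φ x - φ y).toENNReal / edist x y) (𝓝[≠] x)

/-- `w` is a discrete minimizing sequence for `φ` with time step `τ` and initial datum `w₀`: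
`w (i+1)` minimizes `v ↦ φ v + d²(v, w i) / (2τ)` over `X`. -/
def IsDiscreteScheme {X : Type*} [MetricSpace X] (φ : X → EReal) (τ : ℝ) (w₀ : X)
    (w : ℕ → X) : Prop :=
  w 0 = w₀ ∧ ∀ i : ℕ,
    IsMinOn (fun v => φ v + ((1 / (2 * τ) * dist v (w i) ^ 2 : ℝ) : EReal)) univ (w (i + 1))

/-- Piecewise-constant interpolation on `[0, +∞)`: it equals `w (i+1)` on `(iτ, (i+1)τ]`, and
`w 0` at time `0`. -/
def piecewiseConstant {X : Type*} (τ : ℝ) (w : ℕ → X) (t : ℝ) : X :=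
  w ⌈t / τ⌉₊

/-- `u` (considered on `[0, +∞)`) is a minimizing movement along `φ ε` at scale `τ ε` with initial
data `u₀ ε`: a pointwise limit, along some sequence `ε n → 0⁺`, of the piecewise-constant
interpolations of discrete minimizing sequences. -/
def IsMinimizingMovement {X : Type*} [MetricSpace X] (φ : ℝ → X → EReal) (τ : ℝ → ℝ)
    (u₀ : ℝ → X) (u : ℝ → X) : Prop :=
  ∃ w : ℝ → ℕ → X,
    (∀ᶠ ε in 𝓝[>] (0 : ℝ), IsDiscreteScheme (φ ε) (τ ε) (u₀ ε) (w ε)) ∧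
    ∃ ε : ℕ → ℝ, (∀ n, 0 < ε n) ∧ Tendsto ε atTop (𝓝 0) ∧
      ∀ t : ℝ, 0 ≤ t →
        Tendsto (fun n => piecewiseConstant (τ (ε n)) (w (ε n)) t) atTop (𝓝 (u t))

/-- `A ∈ L²(0,T)` and `d(v(s), v(t)) ≤ ∫ₛᵗ A` for all `0 ≤ s ≤ t ≤ T`. -/
def IsSpeedBound {X : Type*} [MetricSpace X] (T : ℝ) (v : ℝ → X) (A : ℝ → ℝ) : Prop :=
  MemLp A 2 (volume.restrict (Ioo 0 T)) ∧
    ∀ s t : ℝ, 0 ≤ s → s ≤ t → t ≤ T → dist (v s) (v t) ≤ ∫ r in s..t, A r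

/-- `v ∈ AC²([0,T]; X)`. -/
def IsAC2 {X : Type*} [MetricSpace X] (T : ℝ) (v : ℝ → X) : Prop :=
  ∃ A : ℝ → ℝ, IsSpeedBound T v A

/-- `m` is the metric derivative `|v'|` on `[0,T]`: the (a.e.) smallest speed bound. -/
def IsMetricDerivative {X : Type*} [MetricSpace X] (T : ℝ) (v : ℝ → X) (m : ℝ → ℝ) : Prop :=
  IsSpeedBound T v m ∧
    ∀ A : ℝ → ℝ, IsSpeedBound T v A → ∀ᵐ r ∂(volume.restrict (Ioo 0 T)), m r ≤ A r

/-- `u` is a curve of maximal slope for `φ` in `[0,T]`. The measurability of `r ↦ |∂φ|(u(r))`,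
which gives the integral its meaning, is part of the definition; the integrals are taken in
`[0, +∞]`, so that the inequality makes them finite. -/
def IsCurveOfMaximalSlope {X : Type*} [MetricSpace X] (φ : X → EReal) (T : ℝ)
    (u : ℝ → X) : Prop :=
  IsAC2 T u ∧
  AEMeasurable (fun r => descendingSlope φ (u r)) (volume.restrict (Icc 0 T)) ∧
  ∃ m : ℝ → ℝ, IsMetricDerivative T u m ∧
  ∃ E : ℝ → ℝ, AntitoneOn E (Icc 0 T) ∧
    (∀ s t : ℝ, 0 ≤ s → s ≤ t → t ≤ T →
      (1 / 2) * (∫⁻ r in Ioo s t, ENNReal.ofReal (m r ^ 2)) +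
        (1 / 2) * (∫⁻ r in Ioo s t, descendingSlope φ (u r) ^ 2) ≤
      ENNReal.ofReal (E s - E t)) ∧
    ∀ᵐ t ∂(volume.restrict (Icc 0 T)), φ (u t) = (E t : EReal)

/-- Condition (H): along `ε n → 0⁺` and `v n → v` with `|φ_{ε n}(v n)| + |∂φ_{ε n}|(v n)` bounded,
the energies converge to `φ v` and the slopes satisfy the liminf inequality. -/
def ConditionH {X : Type*} [MetricSpace X] (φε : ℝ → X → EReal) (φ : X → EReal) : Prop :=
  ∀ (ε : ℕ → ℝ) (v : ℕ → X) (v' : X), (∀ n, 0 < ε n) → Tendsto ε atTop (𝓝 0) →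
    Tendsto v atTop (𝓝 v') →
    (⨆ n, ((φε (ε n) (v n)).abs + descendingSlope (φε (ε n)) (v n))) < ⊤ →
    Tendsto (fun n => φε (ε n) (v n)) atTop (𝓝 (φ v')) ∧
      descendingSlope φ v' ≤ liminf (fun n => descendingSlope (φε (ε n)) (v n)) atTop

end

/- De Giorgi's variational interpolation of an implicit Euler scheme turns the minimality of each
step into an energy-dissipation estimate, with a time lag of one step: the energy lost dominates
half the action of the discrete path plus half the integral of the squared slope along the
interpolation. Energies, actions and lengths are monotone in time, so Helly's selection theorem
extracts pointwise limits and Fatou's lemma passes the estimate to the limit, without lag.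
Condition (H), applied at almost every time along the interpolations, identifies the limit energy
with `φ (u t)` and bounds the slope of `φ` at `u t`. The chain rule gives the reverse differential
inequality almost everywhere, so Young's inequality is an equality there: the slope equals the
derivative of the limit length. This yields both the measurability of the slope and the minimality
of that speed. -/

section MonotoneDerivative

variable {f g F V : ℝ → ℝ} {a b s t : ℝ}

theorem hasDerivAt_le_of_frequently_sub_le (hf : HasDerivAt f a t) (hg : HasDerivAt g b t)
    (h : ∃ᶠ s in 𝓝[>] t, f s - f t ≤ g s - g t) : a ≤ b := by
  have hslope : Tendsto (slope (g - f) t) (𝓝[>] t) (𝓝 (b - a)) :=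
    (hg.sub hf).tendsto_slope.mono_left (nhdsGT_le_nhdsNE t)
  have hfreq : ∃ᶠ s in 𝓝[>] t, 0 ≤ slope (g - f) t s := by
    refine (h.and_eventually self_mem_nhdsWithin).mono fun s ⟨hs, hts⟩ => ?_
    rw [slope_def_field]
    refine div_nonneg ?_ (sub_nonneg.2 (le_of_lt hts))
    simp only [Pi.sub_apply]
    linarith [hs]
  exact sub_nonneg.1 (ge_of_tendsto_of_frequently hslope hfreq)

theorem ae_differentiableAt_of_antitone (hf : Antitone f) : ∀ᵐ t, DifferentiableAt ℝ f t := by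
  filter_upwards [hf.neg.ae_differentiableAt] with t ht
  simpa using ht.neg

theorem integral_deriv_le_of_monotone (hf : Monotone f) (hst : s ≤ t) :
    ∫ r in s..t, deriv f r ≤ f t - f s := by
  have h := (hf.monotoneOn (uIcc s t)).intervalIntegral_deriv_mem_uIcc
  rw [uIcc_of_le (sub_nonneg.2 (hf hst))] at h
  exact h.2

theorem intervalIntegrable_deriv_of_monotone (hf : Monotone f) (s t : ℝ) :
    IntervalIntegrable (deriv f) volume s t :=
  (hf.monotoneOn (uIcc s t)).intervalIntegrable_deriv

theorem lintegral_deriv_le_of_monotone (hf : Monotone f) (hst : s ≤ t) :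
    ∫⁻ r in Ioo s t, ENNReal.ofReal (deriv f r) ≤ ENNReal.ofReal (f t - f s) := by
  have hint : IntegrableOn (deriv f) (Ioo s t) :=
    (intervalIntegrable_iff_integrableOn_Ioo_of_le hst).1
      (intervalIntegrable_deriv_of_monotone hf s t)
  rw [← ofReal_integral_eq_lintegral_ofReal hint (Eventually.of_forall fun _ => hf.deriv_nonneg),
    ← integral_Ioc_eq_integral_Ioo, ← intervalIntegral.integral_of_le hst]
  exact ENNReal.ofReal_le_ofReal (integral_deriv_le_of_monotone hf hst)

/- `f t - f s - ∫ f'` is the mass of the singular part of the Stieltjes measure of `f`. -/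
theorem sub_sub_integral_deriv_le_of_monotone_sub (hf : Monotone f) (hgf : Monotone (g - f))
    (hst : s ≤ t) :
    f t - f s - ∫ r in s..t, deriv f r ≤ g t - g s - ∫ r in s..t, deriv g r := by
  have hg : Monotone g := add_sub_cancel f g ▸ hf.add hgf
  have hderiv : ∫ r in s..t, deriv (g - f) r = ∫ r in s..t, (deriv g r - deriv f r) := by
    refine intervalIntegral.integral_congr_ae ?_
    filter_upwards [hf.ae_differentiableAt, hg.ae_differentiableAt] with r hfr hgr _
    exact deriv_sub hgr hfr
  have hle := integral_deriv_le_of_monotone hgf hst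
  rw [hderiv, intervalIntegral.integral_sub (intervalIntegrable_deriv_of_monotone hg s t)
    (intervalIntegrable_deriv_of_monotone hf s t)] at hle
  simp only [Pi.sub_apply] at hle
  linarith

theorem ae_sq_deriv_le_deriv (hF : Monotone F) (hV : Monotone V)
    (hFV : ∀ s t, s ≤ t → (F t - F s) ^ 2 ≤ (t - s) * (V t - V s)) :
    ∀ᵐ r, deriv F r ^ 2 ≤ deriv V r := by
  filter_upwards [hF.ae_differentiableAt, hV.ae_differentiableAt] with r hFr hVr
  have hF' := hFr.hasDerivAt.tendsto_slope.mono_left (nhdsGT_le_nhdsNE r)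
  have hV' := hVr.hasDerivAt.tendsto_slope.mono_left (nhdsGT_le_nhdsNE r)
  refine le_of_tendsto_of_tendsto (hF'.pow 2) hV' ?_
  filter_upwards [self_mem_nhdsWithin] with s (hs : r < s)
  have hrs : 0 < s - r := sub_pos.2 hs
  rw [slope_def_field, slope_def_field, div_pow, div_le_div_iff₀ (by positivity) hrs]
  nlinarith [hFV r s hs.le]

theorem sub_le_mul_add_mul_of_sq_le {x y z c : ℝ} (hc : 0 < c) (hy : 0 ≤ y) (hz : 0 ≤ z)
    (h : x ^ 2 ≤ y * z) : x ≤ c * z + (4 * c)⁻¹ * y := by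
  refine (abs_le_of_sq_le_sq' (h.trans ?_) (by positivity)).2
  have hyz : y * z = 4 * (c * z) * ((4 * c)⁻¹ * y) := by field_simp
  linarith [sq_nonneg (c * z - (4 * c)⁻¹ * y)]

/- For every `c > 0`, increments of `F` are dominated by those of `c * V` plus a linear function, so
the singular part of `F` is at most `c` times that of `V`. -/
theorem sub_le_integral_deriv_of_sq_sub_le (hF : Monotone F) (hV : Monotone V)
    (hFV : ∀ s t, s ≤ t → (F t - F s) ^ 2 ≤ (t - s) * (V t - V s)) (hst : s ≤ t) :
    F t - F s ≤ ∫ r in s..t, deriv F r := by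
  have hsing : ∀ c : ℝ, 0 < c →
      F t - F s - ∫ r in s..t, deriv F r ≤ c * (V t - V s - ∫ r in s..t, deriv V r) := by
    intro c hc
    set G : ℝ → ℝ := fun r => c * V r + (4 * c)⁻¹ * r
    have hGF : Monotone (G - F) := fun x y hxy => by
      have := sub_le_mul_add_mul_of_sq_le hc (sub_nonneg.2 hxy) (sub_nonneg.2 (hV hxy))
        (hFV x y hxy)
      simp only [Pi.sub_apply, G]
      linarith
    have hderiv : ∫ r in s..t, deriv G r = ∫ r in s..t, (c * deriv V r + (4 * c)⁻¹) := by
      refine intervalIntegral.integral_congr_ae ?_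
      filter_upwards [hV.ae_differentiableAt] with r hVr _
      have hGr := ((hVr.hasDerivAt.const_mul c).add ((hasDerivAt_id r).const_mul (4 * c)⁻¹)).deriv
      rwa [mul_one] at hGr
    have hle := sub_sub_integral_deriv_le_of_monotone_sub hF hGF hst
    rw [hderiv, intervalIntegral.integral_add
      ((intervalIntegrable_deriv_of_monotone hV s t).const_mul c) (by simp),
      intervalIntegral.integral_const_mul, intervalIntegral.integral_const] at hle
    simp only [smul_eq_mul, G] at hle
    linarith
  set m : ℝ := V t - V s - ∫ r in s..t, deriv V r
  have hlim : Tendsto (fun c : ℝ => c * m) (𝓝[>] 0) (𝓝 0) := by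
    simpa using ((continuous_mul_const m).tendsto 0).mono_left nhdsWithin_le_nhds
  exact sub_nonpos.1 (ge_of_tendsto hlim (eventually_mem_nhdsWithin.mono hsing))

theorem ae_le_deriv_of_lintegral_le {Q : ℝ → ℝ≥0∞} {T : ℝ} (hf : Monotone f) (hQ : Measurable Q)
    (hT : 0 < T) (hQf : ∀ s t, 0 ≤ s → s ≤ t → t ≤ T →
      ∫⁻ r in Ioo s t, Q r ≤ ENNReal.ofReal (f t - f s)) :
    ∀ᵐ t ∂(volume.restrict (Ioo 0 T)), Q t ≤ ENNReal.ofReal (deriv f t) := by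
  have hfin : ∫⁻ r in Ioo 0 T, Q r ≠ ⊤ :=
    ((hQf 0 T le_rfl hT.le le_rfl).trans_lt ENNReal.ofReal_lt_top).ne
  have hlt := ae_lt_top hQ hfin
  have hint : IntervalIntegrable (fun r => (Q r).toReal) volume 0 T :=
    (intervalIntegrable_iff_integrableOn_Ioo_of_le hT.le).2
      (integrable_toReal_of_lintegral_ne_top hQ.aemeasurable hfin)
  have hint' : ∀ {s}, 0 ≤ s → s ≤ T → IntervalIntegrable (fun r => (Q r).toReal) volume 0 s :=
    fun h0 hT' => hint.mono_set (uIcc_subset_uIcc_left (by rw [uIcc_of_le hT.le]; exact ⟨h0, hT'⟩))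
  filter_upwards [hlt, ae_restrict_mem measurableSet_Ioo, ae_restrict_of_ae hf.ae_differentiableAt,
    ae_restrict_of_ae hint.ae_hasDerivAt_integral] with t hQt ht hft hIt
  rw [ENNReal.le_ofReal_iff_toReal_le hQt.ne hf.deriv_nonneg]
  refine hasDerivAt_le_of_frequently_sub_le
    (hIt (by rw [uIcc_of_le hT.le]; exact Ioo_subset_Icc_self ht) 0 (by simp)) hft.hasDerivAt
    (Eventually.frequently ?_)
  filter_upwards [Ioo_mem_nhdsGT ht.2] with s hs
  rw [intervalIntegral.integral_interval_sub_left (hint' (ht.1.trans hs.1).le hs.2.le)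
    (hint' ht.1.le ht.2.le), intervalIntegral.integral_of_le hs.1.le,
    integral_Ioc_eq_integral_Ioo, integral_toReal hQ.aemeasurable
    (ae_restrict_of_ae_restrict_of_subset (Ioo_subset_Ioo ht.1.le hs.2.le) hlt)]
  exact ENNReal.toReal_le_of_le_ofReal (sub_nonneg.2 (hf hs.1.le)) (hQf t s ht.1.le hs.1.le hs.2.le)

theorem frequently_nhdsGT_of_ae_restrict {p : ℝ → Prop} (ht : t ∈ Ioo a b)
    (hp : ∀ᵐ s ∂(volume.restrict (Ioo a b)), p s) : ∃ᶠ s in 𝓝[>] t, p s := by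
  intro hnot
  obtain ⟨c, hc, hsub⟩ :=
    mem_nhdsGT_iff_exists_Ioo_subset.1 (inter_mem hnot (Ioo_mem_nhdsGT ht.2))
  have hp' : ∀ᵐ s ∂(volume.restrict (Ioo t c)), p s :=
    ae_restrict_of_ae_restrict_of_subset (s := Ioo t c) (t := Ioo a b)
      (fun x hx => ⟨ht.1.trans hx.1, (hsub hx).2.2⟩) hp
  have hfalse : ∀ᵐ _ ∂(volume.restrict (Ioo t c)), False := by
    filter_upwards [hp', ae_restrict_mem measurableSet_Ioo] with _ hs hs'
    exact (hsub hs').1 hs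
  have hzero : volume.restrict (Ioo t c) = 0 :=
    ae_eq_bot.1 (eventually_false_iff_eq_bot.1 hfalse)
  rw [Measure.restrict_eq_zero, Real.volume_Ioo, ENNReal.ofReal_eq_zero, sub_nonpos] at hzero
  exact hzero.not_gt hc

end MonotoneDerivative

section Helly

variable {ι α κ : Type*} [LinearOrder ι] [TopologicalSpace ι] [OrderTopology ι] [DenselyOrdered ι]
  [NoMinOrder ι] [NoMaxOrder ι]

theorem tendsto_apply_of_monotone_of_tendsto_on_dense [LinearOrder α] [TopologicalSpace α]
    [OrderTopology α] {l : Filter κ} {f : κ → ι → α} {g : ι → α} {D : Set ι} {s : κ → ι} {t : ι}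
    (hf : ∀ n, Monotone (f n)) (hD : Dense D)
    (hfg : ∀ d ∈ D, Tendsto (fun n => f n d) l (𝓝 (g d))) (hg : ContinuousAt g t)
    (hs : Tendsto s l (𝓝 t)) : Tendsto (fun n => f n (s n)) l (𝓝 (g t)) := by
  refine tendsto_order.2 ⟨fun a ha => ?_, fun a ha => ?_⟩
  · obtain ⟨c, hc, hsub⟩ := exists_Ioc_subset_of_mem_nhds (hg.eventually (lt_mem_nhds ha))
      (exists_lt t)
    obtain ⟨d, hd, hcd, hdt⟩ := hD.exists_between hc
    filter_upwards [(hfg d hd).eventually (lt_mem_nhds (hsub ⟨hcd, hdt.le⟩)),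
      hs.eventually (lt_mem_nhds hdt)] with n hn hdn
    exact hn.trans_le (hf n hdn.le)
  · obtain ⟨c, hc, hsub⟩ := exists_Ico_subset_of_mem_nhds (hg.eventually (gt_mem_nhds ha))
      (exists_gt t)
    obtain ⟨d, hd, htd, hdc⟩ := hD.exists_between hc
    filter_upwards [(hfg d hd).eventually (gt_mem_nhds (hsub ⟨htd.le, hdc⟩)),
      hs.eventually (gt_mem_nhds htd)] with n hn hnd
    exact (hf n hnd.le).trans_lt hn

theorem exists_subseq_tendsto_of_monotone [SecondCountableTopology ι] [CompleteLinearOrder α]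
    [TopologicalSpace α] [OrderTopology α] [SecondCountableTopology α] {f : ℕ → ι → α}
    (hf : ∀ n, Monotone (f n)) : ∃ k : ℕ → ℕ, StrictMono k ∧
      ∀ t, ∃ a, Tendsto (fun n => f (k n) t) atTop (𝓝 a) := by
  have hsub : ∀ (D : Set ι), D.Countable → ∀ f : ℕ → ι → α, ∃ k : ℕ → ℕ, StrictMono k ∧
      ∀ t ∈ D, ∃ a, Tendsto (fun n => f (k n) t) atTop (𝓝 a) := by
    intro D hD f
    have := hD.to_subtype
    obtain ⟨a, k, hk, ha⟩ := CompactSpace.tendsto_subseq fun n (d : D) => f n d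
    exact ⟨k, hk, fun t ht => ⟨a ⟨t, ht⟩, tendsto_pi_nhds.1 ha ⟨t, ht⟩⟩⟩
  obtain ⟨D, hDc, hD⟩ := TopologicalSpace.exists_countable_dense ι
  obtain ⟨k, hk, hkD⟩ := hsub D hDc f
  set g : ι → α := fun t => liminf (fun n => f (k n) t) atTop
  have hg : Monotone g := fun s t hst =>
    liminf_le_liminf (Eventually.of_forall fun n => hf (k n) hst)
  have hgD : ∀ d ∈ D, Tendsto (fun n => f (k n) d) atTop (𝓝 (g d)) := fun d hd => by
    obtain ⟨a, ha⟩ := hkD d hd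
    simpa only [g, ha.liminf_eq] using ha
  obtain ⟨j, hj, hjC⟩ := hsub {t | ¬ContinuousAt g t} hg.countable_not_continuousAt
    fun n => f (k n)
  refine ⟨k ∘ j, hk.comp hj, fun t => ?_⟩
  by_cases ht : ContinuousAt g t
  · exact ⟨g t, (tendsto_apply_of_monotone_of_tendsto_on_dense (fun n => hf (k n)) hD hgD ht
      tendsto_const_nhds).comp hj.tendsto_atTop⟩
  · exact hjC t ht

theorem exists_subseq_tendsto_of_monotone_of_bounded [SecondCountableTopology ι] {f : ℕ → ι → ℝ}
    (hf : ∀ n, Monotone (f n)) (hbdd : ∀ t, ∃ B, ∀ᶠ n in atTop, |f n t| ≤ B) :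
    ∃ k : ℕ → ℕ, StrictMono k ∧ ∃ g : ι → ℝ, ∀ t, Tendsto (fun n => f (k n) t) atTop (𝓝 (g t)) := by
  obtain ⟨k, hk, hlim⟩ := exists_subseq_tendsto_of_monotone (f := fun n t => (f n t : EReal))
    fun n s t hst => EReal.coe_le_coe_iff.2 (hf n hst)
  have hreal : ∀ t, ∃ a : ℝ, Tendsto (fun n => f (k n) t) atTop (𝓝 a) := by
    intro t
    obtain ⟨a, ha⟩ := hlim t
    obtain ⟨B, hB⟩ := hbdd t
    have hBk := hk.tendsto_atTop.eventually hB
    have hle : a ≤ (B : EReal) := le_of_tendsto ha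
      (hBk.mono fun n hn => EReal.coe_le_coe_iff.2 (abs_le.1 hn).2)
    have hge : ((-B : ℝ) : EReal) ≤ a := ge_of_tendsto ha
      (hBk.mono fun n hn => EReal.coe_le_coe_iff.2 (abs_le.1 hn).1)
    lift a to ℝ using ⟨(hle.trans_lt (EReal.coe_lt_top B)).ne,
      ((EReal.bot_lt_coe _).trans_le hge).ne'⟩
    exact ⟨a, EReal.tendsto_coe.1 ha⟩
  choose g hg using hreal
  exact ⟨k, hk, g, hg⟩

end Helly

section ChainRule

variable {X : Type*} [MetricSpace X] {φ : X → EReal}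

theorem eventually_sub_le_of_descendingSlope_lt {x : X} {c : ℝ}
    (h : descendingSlope φ x < ENNReal.ofReal c) :
    ∀ᶠ y in 𝓝 x, (φ x - φ y).toENNReal ≤ ENNReal.ofReal c * edist x y := by
  have hx : φ x ≠ ⊤ := by
    intro hx
    simp [descendingSlope, hx] at h
  rw [descendingSlope, if_neg hx] at h
  filter_upwards [eventually_nhdsWithin_iff.1 (eventually_lt_of_limsup_lt h)] with y hy
  rcases eq_or_ne y x with rfl | hxy
  · simp [EReal.toENNReal_of_nonpos EReal.sub_self_le_zero]
  · exact ((ENNReal.div_lt_iff (Or.inl (edist_pos.2 hxy.symm).ne')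
      (Or.inl (edist_ne_top _ _))).1 (hy hxy)).le

theorem tendsto_nhdsGT_of_dist_le {u : ℝ → X} {I : ℝ → ℝ} {t : ℝ} (hI : ContinuousAt I t)
    (hu : ∀ᶠ s in 𝓝[>] t, dist (u t) (u s) ≤ I s - I t) : Tendsto u (𝓝[>] t) (𝓝 (u t)) := by
  have hI' : Tendsto (fun s => I s - I t) (𝓝[>] t) (𝓝 0) := by
    simpa using (hI.tendsto.mono_left nhdsWithin_le_nhds).sub_const (I t)
  refine tendsto_iff_dist_tendsto_zero.2
    (squeeze_zero' (Eventually.of_forall fun _ => dist_nonneg) ?_ hI')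
  simpa only [dist_comm] using hu

theorem neg_deriv_le_descendingSlope_mul {u : ℝ → X} {E I : ℝ → ℝ} {e b t : ℝ}
    (hE : HasDerivAt E e t) (hI : HasDerivAt I b t) (hφt : φ (u t) = (E t : EReal))
    (hφ : ∃ᶠ s in 𝓝[>] t, φ (u s) = (E s : EReal))
    (hu : ∀ᶠ s in 𝓝[>] t, dist (u t) (u s) ≤ I s - I t) (hfin : descendingSlope φ (u t) ≠ ⊤) :
    -e ≤ (descendingSlope φ (u t)).toReal * b := by
  have hbound : ∀ c : ℝ, (descendingSlope φ (u t)).toReal < c → -e ≤ c * b := by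
    intro c hc
    have hc0 : 0 ≤ c := ENNReal.toReal_nonneg.trans hc.le
    have hslope := (tendsto_nhdsGT_of_dist_le hI.continuousAt hu).eventually
      (eventually_sub_le_of_descendingSlope_lt ((ENNReal.lt_ofReal_iff_toReal_lt hfin).2 hc))
    refine hasDerivAt_le_of_frequently_sub_le hE.neg (hI.const_mul c)
      ((hφ.and_eventually (hslope.and hu)).mono ?_)
    rintro s ⟨hφs, hs, hds⟩
    rw [hφt, hφs, ← EReal.coe_sub, EReal.toENNReal_of_ne_top (EReal.coe_ne_top _),
      EReal.toReal_coe, edist_dist, ← ENNReal.ofReal_mul hc0,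
      ENNReal.ofReal_le_ofReal_iff (by positivity)] at hs
    have hcd := mul_le_mul_of_nonneg_left hds hc0
    simp only [Pi.neg_apply]
    linarith
  have hlim : Tendsto (fun c => c * b) (𝓝[>] (descendingSlope φ (u t)).toReal)
      (𝓝 ((descendingSlope φ (u t)).toReal * b)) :=
    ((continuous_mul_const b).tendsto _).mono_left nhdsWithin_le_nhds
  exact ge_of_tendsto hlim (eventually_mem_nhdsWithin.mono hbound)

namespace IsSpeedBound

variable {u : ℝ → X} {A E : ℝ → ℝ} {T : ℝ}

theorem ae_hasDerivAt_and_dist_le (hA : IsSpeedBound T u A) (hT : 0 < T) :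
    ∀ᵐ t ∂(volume.restrict (Ioo 0 T)), HasDerivAt (fun s => ∫ r in (0 : ℝ)..s, A r) (A t) t ∧
      ∀ᶠ s in 𝓝[>] t, dist (u t) (u s) ≤ (∫ r in (0 : ℝ)..s, A r) - ∫ r in (0 : ℝ)..t, A r := by
  have hint : IntervalIntegrable A volume 0 T :=
    (intervalIntegrable_iff_integrableOn_Ioo_of_le hT.le).2 (hA.1.integrable (by norm_num))
  have hint' : ∀ {s}, 0 ≤ s → s ≤ T → IntervalIntegrable A volume 0 s := fun h0 hsT =>
    hint.mono_set (uIcc_subset_uIcc_left (by rw [uIcc_of_le hT.le]; exact ⟨h0, hsT⟩))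
  filter_upwards [ae_restrict_mem measurableSet_Ioo,
    ae_restrict_of_ae hint.ae_hasDerivAt_integral] with t ht hderiv
  refine ⟨hderiv (by rw [uIcc_of_le hT.le]; exact Ioo_subset_Icc_self ht) 0 (by simp), ?_⟩
  filter_upwards [Ioo_mem_nhdsGT ht.2] with s hs
  rw [intervalIntegral.integral_interval_sub_left (hint' (ht.1.trans hs.1).le hs.2.le)
    (hint' ht.1.le ht.2.le)]
  exact hA.2 t s ht.1.le hs.1.le hs.2.le

theorem ae_nonneg (hA : IsSpeedBound T u A) (hT : 0 < T) :
    ∀ᵐ t ∂(volume.restrict (Ioo 0 T)), 0 ≤ A t := by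
  filter_upwards [hA.ae_hasDerivAt_and_dist_le hT] with t ⟨hderiv, hdist⟩
  refine hasDerivAt_le_of_frequently_sub_le (hasDerivAt_const t (0 : ℝ)) hderiv
    (hdist.mono fun s hs => ?_).frequently
  simpa using dist_nonneg.trans hs

theorem ae_neg_deriv_le (hA : IsSpeedBound T u A) (hT : 0 < T) (hE : Antitone E)
    (hφ : ∀ᵐ t ∂(volume.restrict (Ioo 0 T)), φ (u t) = (E t : EReal)) :
    ∀ᵐ t ∂(volume.restrict (Ioo 0 T)), descendingSlope φ (u t) ≠ ⊤ →
      -deriv E t ≤ (descendingSlope φ (u t)).toReal * A t := by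
  filter_upwards [hφ, ae_restrict_mem measurableSet_Ioo, hA.ae_hasDerivAt_and_dist_le hT,
    ae_restrict_of_ae (ae_differentiableAt_of_antitone hE)] with t hφt ht ⟨hderiv, hdist⟩ hEt
  exact neg_deriv_le_descendingSlope_mul hEt.hasDerivAt hderiv hφt
    (frequently_nhdsGT_of_ae_restrict ht hφ) hdist

end IsSpeedBound

end ChainRule

/-- Energy–dissipation estimate with time lag `τ` along a trajectory `u`: `E` is the energy, `F` and
`V` play the roles of `∫₀ᵗ |u'|` and `∫₀ᵗ |u'|²`, and `H` that of the squared slope along `u`.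
Discrete schemes satisfy it with lag the time step, curves of maximal slope with lag `0`. -/
structure HasDissipationBound {X : Type*} [MetricSpace X] (τ : ℝ) (u : ℝ → X) (E V F : ℝ → ℝ)
    (H : ℝ → ℝ≥0∞) : Prop where
  antitone_energy : Antitone E
  monotone_action : Monotone V
  monotone_length : Monotone F
  action_eq_zero : ∀ t ≤ 0, V t = 0
  length_eq_zero : ∀ t ≤ 0, F t = 0
  dist_le : ∀ s t, 0 ≤ s → s ≤ t → dist (u s) (u t) ≤ F t - F s
  sq_length_le : ∀ s t, s ≤ t → (F t - F s) ^ 2 ≤ (t - s + τ) * (V t - V s)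
  action_le : ∀ s t, s ≤ t → V t - V s ≤ 2 * (E s - E t)
  measurable : Measurable H
  lintegral_le : ∀ s t, 0 ≤ s → s ≤ t →
    ∫⁻ r in Ioo (s + τ) t, H r ≤ ENNReal.ofReal (2 * (E s - E t) - (V t - V s))

namespace HasDissipationBound

section ZeroLag

variable {X : Type*} [MetricSpace X] {φ : X → EReal} {u : ℝ → X} {E V F : ℝ → ℝ} {H : ℝ → ℝ≥0∞}
  {T s t : ℝ}

theorem ae_sq_deriv_length_le (h : HasDissipationBound 0 u E V F H) :
    ∀ᵐ r, deriv F r ^ 2 ≤ deriv V r :=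
  ae_sq_deriv_le_deriv h.monotone_length h.monotone_action
    (by simpa only [add_zero] using h.sq_length_le)

theorem lintegral_sq_deriv_length_le (h : HasDissipationBound 0 u E V F H) (hst : s ≤ t) :
    ∫⁻ r in Ioo s t, ENNReal.ofReal (deriv F r ^ 2) ≤ ENNReal.ofReal (V t - V s) :=
  (lintegral_mono_ae (ae_restrict_of_ae
    (h.ae_sq_deriv_length_le.mono fun _ hr => ENNReal.ofReal_le_ofReal hr))).trans
      (lintegral_deriv_le_of_monotone h.monotone_action hst)

theorem isSpeedBound_deriv_length (h : HasDissipationBound 0 u E V F H) (hT : 0 < T) :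
    IsSpeedBound T u (deriv F) := by
  have hF : AEStronglyMeasurable (deriv F) (volume.restrict (Ioo 0 T)) :=
    (measurable_deriv F).aestronglyMeasurable
  refine ⟨(memLp_two_iff_integrable_sq hF).2 ⟨hF.pow 2, ?_⟩, fun s t h0 hst _ =>
    (h.dist_le s t h0 hst).trans (sub_le_integral_deriv_of_sq_sub_le h.monotone_length
      h.monotone_action (by simpa only [add_zero] using h.sq_length_le) hst)⟩
  rw [hasFiniteIntegral_iff_ofReal (Eventually.of_forall fun r => sq_nonneg _)]
  exact (h.lintegral_sq_deriv_length_le hT.le).trans_lt ENNReal.ofReal_lt_top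

theorem ae_add_le_neg_deriv_energy (h : HasDissipationBound 0 u E V F H) (hT : 0 < T) :
    ∀ᵐ t ∂(volume.restrict (Ioo 0 T)), H t ≠ ⊤ ∧
      deriv F t ^ 2 + (H t).toReal ≤ -(2 * deriv E t) := by
  have hmono : Monotone fun t => -(2 * E t + V t) := fun x y hxy => by
    linarith [h.action_le x y hxy]
  have hH := ae_le_deriv_of_lintegral_le hmono h.measurable hT fun s t h0 hst _ => by
    simpa only [add_zero, mul_sub, neg_add_rev, neg_sub_neg, ← sub_sub, sub_neg_eq_add]
      using (h.lintegral_le s t h0 hst).trans (ENNReal.ofReal_le_ofReal (by linarith))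
  filter_upwards [hH, ae_restrict_of_ae h.ae_sq_deriv_length_le,
    ae_restrict_of_ae (ae_differentiableAt_of_antitone h.antitone_energy),
    ae_restrict_of_ae h.monotone_action.ae_differentiableAt] with t hHt hFV hE hV
  have hfin : H t ≠ ⊤ := ne_top_of_le_ne_top ENNReal.ofReal_ne_top hHt
  have hderiv : deriv (fun t => -(2 * E t + V t)) t = -(2 * deriv E t + deriv V t) :=
    ((hE.hasDerivAt.const_mul 2).add hV.hasDerivAt).neg.deriv
  rw [ENNReal.le_ofReal_iff_toReal_le hfin hmono.deriv_nonneg, hderiv] at hHt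
  exact ⟨hfin, by linarith⟩

/- The chain rule bounds `-E'` by `|∂φ|(u) F'`, the dissipation bound bounds it from below by
`(F'² + |∂φ|²(u)) / 2`: this is the equality case of Young's inequality. -/
theorem ae_descendingSlope_eq (h : HasDissipationBound 0 u E V F H) (hT : 0 < T)
    (hφ : ∀ᵐ t ∂(volume.restrict (Ioo 0 T)), φ (u t) = (E t : EReal))
    (hH : ∀ᵐ t ∂(volume.restrict (Ioo 0 T)), descendingSlope φ (u t) ^ 2 ≤ H t) :
    ∀ᵐ t ∂(volume.restrict (Ioo 0 T)),
      descendingSlope φ (u t) = ENNReal.ofReal (deriv F t) ∧ deriv F t ^ 2 ≤ -deriv E t := by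
  filter_upwards [h.ae_add_le_neg_deriv_energy hT, hH,
    (h.isSpeedBound_deriv_length hT).ae_neg_deriv_le hT h.antitone_energy hφ]
    with t ⟨hfin, hYoung⟩ hslope hchain
  have hfin' : descendingSlope φ (u t) ≠ ⊤ := by
    intro htop
    rw [htop, ENNReal.top_pow two_ne_zero] at hslope
    exact hfin (top_le_iff.1 hslope)
  have hsq := ENNReal.toReal_mono hfin hslope
  rw [ENNReal.toReal_pow] at hsq
  have hchain := hchain hfin'
  have heq : (descendingSlope φ (u t)).toReal = deriv F t := by nlinarith
  exact ⟨by rw [← heq, ENNReal.ofReal_toReal hfin'], by rw [heq] at hsq; linarith⟩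

theorem isMetricDerivative_deriv_length (h : HasDissipationBound 0 u E V F H) (hT : 0 < T)
    (hφ : ∀ᵐ t ∂(volume.restrict (Ioo 0 T)), φ (u t) = (E t : EReal))
    (hH : ∀ᵐ t ∂(volume.restrict (Ioo 0 T)), descendingSlope φ (u t) ^ 2 ≤ H t) :
    IsMetricDerivative T u (deriv F) := by
  refine ⟨h.isSpeedBound_deriv_length hT, fun A hA => ?_⟩
  filter_upwards [h.ae_descendingSlope_eq hT hφ hH, hA.ae_nonneg hT,
    hA.ae_neg_deriv_le hT h.antitone_energy hφ] with t ⟨hslope, hsq⟩ hA0 hchain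
  have hF0 : 0 ≤ deriv F t := h.monotone_length.deriv_nonneg
  rw [hslope, ENNReal.toReal_ofReal hF0] at hchain
  have hchain := hchain ENNReal.ofReal_ne_top
  rcases hF0.eq_or_lt with hF | hF
  · rwa [← hF]
  · nlinarith

theorem half_lintegral_add_half_lintegral_le (h : HasDissipationBound 0 u E V F H) (h0 : 0 ≤ s)
    (hst : s ≤ t) :
    (1 / 2) * (∫⁻ r in Ioo s t, ENNReal.ofReal (deriv F r ^ 2)) + (1 / 2) * (∫⁻ r in Ioo s t, H r) ≤
      ENNReal.ofReal (E s - E t) := by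
  have hH := h.lintegral_le s t h0 hst
  rw [add_zero] at hH
  calc _ ≤ 1 / 2 * ENNReal.ofReal (V t - V s) +
        1 / 2 * ENNReal.ofReal (2 * (E s - E t) - (V t - V s)) := by
        gcongr
        exact h.lintegral_sq_deriv_length_le hst
    _ = ENNReal.ofReal (1 / 2) * ENNReal.ofReal (2 * (E s - E t)) := by
        rw [← mul_add, ← ENNReal.ofReal_add (sub_nonneg.2 (h.monotone_action hst))
          (sub_nonneg.2 (h.action_le s t hst)), add_sub_cancel,
          ENNReal.ofReal_div_of_pos zero_lt_two, ENNReal.ofReal_one, ENNReal.ofReal_ofNat]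
    _ = ENNReal.ofReal (E s - E t) := by
        rw [← ENNReal.ofReal_mul (by norm_num)]
        ring_nf

theorem isCurveOfMaximalSlope (h : HasDissipationBound 0 u E V F H) (hT : 0 < T)
    (hφ : ∀ᵐ t ∂(volume.restrict (Ioo 0 T)), φ (u t) = (E t : EReal))
    (hH : ∀ᵐ t ∂(volume.restrict (Ioo 0 T)), descendingSlope φ (u t) ^ 2 ≤ H t) :
    IsCurveOfMaximalSlope φ T u := by
  have hIcc : volume.restrict (Icc 0 T) = volume.restrict (Ioo 0 T) :=
    restrict_Ioo_eq_restrict_Icc.symm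
  refine ⟨⟨_, h.isSpeedBound_deriv_length hT⟩, ?_, deriv F,
    h.isMetricDerivative_deriv_length hT hφ hH, E, h.antitone_energy.antitoneOn _,
    fun s t h0 hst htT => ?_, by rwa [hIcc]⟩
  · rw [hIcc]
    exact (measurable_deriv F).ennreal_ofReal.aemeasurable.congr
      ((h.ae_descendingSlope_eq hT hφ hH).mono fun t ht => ht.1.symm)
  · refine le_trans ?_ (h.half_lintegral_add_half_lintegral_le h0 hst)
    gcongr _ + _ * ?_
    exact lintegral_mono_ae (ae_restrict_of_ae_restrict_of_subset (Ioo_subset_Ioo h0 htT) hH)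

end ZeroLag

end HasDissipationBound

noncomputable section Proximal

variable {X : Type*} [MetricSpace X] {φ : X → EReal}

theorem descendingSlope_le_of_sub_le {f : X → ℝ≥0∞} {x : X} (hx : φ x ≠ ⊤) (hf : ContinuousAt f x)
    (hφ : ∀ y, (φ x - φ y).toENNReal ≤ f y * edist x y) : descendingSlope φ x ≤ f x := by
  rw [descendingSlope, if_neg hx]
  have hle : ∀ y, (φ x - φ y).toENNReal / edist x y ≤ f y := fun y =>
    ENNReal.div_le_of_le_mul (hφ y)
  refine le_of_forall_gt fun c hc => ?_
  obtain ⟨b, hxb, hbc⟩ := exists_between hc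
  refine (limsup_le_of_le (by isBoundedDefault) ?_).trans_lt hbc
  filter_upwards [(hf.tendsto.mono_left nhdsWithin_le_nhds).eventually_le_const hxb] with y hy
  exact (hle y).trans hy

theorem exists_isMinOn_univ_of_sublevel_subset {β : Type*} [LinearOrder β] {f : X → β} {K : Set X}
    {w : X} (hf : LowerSemicontinuous f) (hK : IsCompact K) (hfK : {x | f x ≤ f w} ⊆ K) :
    ∃ v, IsMinOn f univ v := by
  have hwK : w ∈ K := hfK (le_refl (f w))
  obtain ⟨v, -, hv⟩ := (hf.lowerSemicontinuousOn K).exists_isMinOn ⟨w, hwK⟩ hK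
  refine ⟨v, isMinOn_univ_iff.2 fun y => ?_⟩
  rcases le_total (f y) (f w) with hy | hy
  · exact isMinOn_iff.1 hv y (hfK hy)
  · exact (isMinOn_iff.1 hv w hwK).trans hy

theorem ne_bot_of_coe_le_add_coe {x : EReal} {a c : ℝ} (h : (c : EReal) ≤ x + a) : x ≠ ⊥ := by
  rintro rfl
  rw [EReal.bot_add] at h
  exact EReal.coe_ne_bot c (le_bot_iff.1 h)

theorem le_toReal_add_of_coe_le_add_coe {x : EReal} {a c : ℝ} (h : (c : EReal) ≤ x + a)
    (hx : x ≠ ⊤) : c ≤ x.toReal + a := by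
  lift x to ℝ using ⟨hx, ne_bot_of_coe_le_add_coe h⟩
  exact_mod_cast h

/-- `v` minimizes `x ↦ φ x + d²(x, w) / (2σ)`, i.e. it is obtained from `w` by one implicit Euler
step of length `σ`. -/
def IsProximal (φ : X → EReal) (σ : ℝ) (w v : X) : Prop :=
  IsMinOn (fun x => φ x + ((1 / (2 * σ) * dist x w ^ 2 : ℝ) : EReal)) univ v

/-- The real value at `v` of the functional minimized in `IsProximal`; it is only meaningful where
`φ v` is finite. -/
def proximalEnergy (φ : X → EReal) (σ : ℝ) (w v : X) : ℝ :=
  (φ v).toReal + 1 / (2 * σ) * dist v w ^ 2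

theorem proximalEnergy_self (φ : X → EReal) (σ : ℝ) (w : X) :
    proximalEnergy φ σ w w = (φ w).toReal := by
  simp [proximalEnergy]

theorem proximalEnergy_sub_proximalEnergy (φ : X → EReal) (σ₁ σ₂ : ℝ) (w v : X) :
    proximalEnergy φ σ₁ w v - proximalEnergy φ σ₂ w v =
      dist v w ^ 2 / 2 * (σ₁⁻¹ - σ₂⁻¹) := by
  simp only [proximalEnergy]
  ring

namespace IsProximal

variable {σ σ₁ σ₂ : ℝ} {w v v₁ v₂ y : X}

theorem le_self (h : IsProximal φ σ w v) (hσ : 0 < σ) : φ v ≤ φ w := by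
  have hle := isMinOn_univ_iff.1 h w
  simp only [dist_self, ne_eq, OfNat.ofNat_ne_zero, not_false_eq_true, zero_pow, mul_zero,
    EReal.coe_zero, add_zero] at hle
  exact (le_add_of_nonneg_right (EReal.coe_nonneg.2 (by positivity))).trans hle

theorem ne_top (h : IsProximal φ σ w v) (hσ : 0 < σ) (hw : φ w ≠ ⊤) : φ v ≠ ⊤ :=
  ne_top_of_le_ne_top hw (h.le_self hσ)

theorem proximalEnergy_le (h : IsProximal φ σ w v) (hbot : ∀ x, φ x ≠ ⊥) (hv : φ v ≠ ⊤)
    (hy : φ y ≠ ⊤) : proximalEnergy φ σ w v ≤ proximalEnergy φ σ w y := by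
  have hle := isMinOn_univ_iff.1 h y
  rwa [← EReal.coe_toReal hv (hbot v), ← EReal.coe_toReal hy (hbot y), ← EReal.coe_add,
    ← EReal.coe_add, EReal.coe_le_coe_iff] at hle

theorem proximalEnergy_le_self (h : IsProximal φ σ w v) (hbot : ∀ x, φ x ≠ ⊥) (hσ : 0 < σ)
    (hw : φ w ≠ ⊤) : proximalEnergy φ σ w v ≤ (φ w).toReal :=
  (h.proximalEnergy_le hbot (h.ne_top hσ hw) hw).trans_eq (proximalEnergy_self φ σ w)

theorem mul_inv_sub_inv_le (h₁ : IsProximal φ σ₁ w v₁) (h₂ : IsProximal φ σ₂ w v₂)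
    (hbot : ∀ x, φ x ≠ ⊥) (hσ₁ : 0 < σ₁) (hσ₂ : 0 < σ₂) (hw : φ w ≠ ⊤) :
    dist v₁ w ^ 2 / 2 * (σ₁⁻¹ - σ₂⁻¹) ≤ proximalEnergy φ σ₁ w v₁ - proximalEnergy φ σ₂ w v₂ := by
  rw [← proximalEnergy_sub_proximalEnergy φ]
  exact sub_le_sub_left (h₂.proximalEnergy_le hbot (h₂.ne_top hσ₂ hw) (h₁.ne_top hσ₁ hw)) _

theorem proximalEnergy_anti (h₁ : IsProximal φ σ₁ w v₁) (h₂ : IsProximal φ σ₂ w v₂)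
    (hbot : ∀ x, φ x ≠ ⊥) (hσ₁ : 0 < σ₁) (hσ : σ₁ ≤ σ₂) (hw : φ w ≠ ⊤) :
    proximalEnergy φ σ₂ w v₂ ≤ proximalEnergy φ σ₁ w v₁ := by
  have hle := h₁.mul_inv_sub_inv_le h₂ hbot hσ₁ (hσ₁.trans_le hσ) hw
  have hinv : 0 ≤ σ₁⁻¹ - σ₂⁻¹ := sub_nonneg.2 (inv_anti₀ hσ₁ hσ)
  exact sub_nonneg.1 ((by positivity : 0 ≤ dist v₁ w ^ 2 / 2 * (σ₁⁻¹ - σ₂⁻¹)).trans hle)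

theorem dist_le_dist (h₁ : IsProximal φ σ₁ w v₁) (h₂ : IsProximal φ σ₂ w v₂)
    (hbot : ∀ x, φ x ≠ ⊥) (hσ₁ : 0 < σ₁) (hσ : σ₁ < σ₂) (hw : φ w ≠ ⊤) :
    dist v₁ w ≤ dist v₂ w := by
  have hσ₂ : 0 < σ₂ := hσ₁.trans hσ
  have h₁₂ := h₁.mul_inv_sub_inv_le h₂ hbot hσ₁ hσ₂ hw
  have h₂₁ := h₂.mul_inv_sub_inv_le h₁ hbot hσ₂ hσ₁ hw
  have hinv : 0 < σ₁⁻¹ - σ₂⁻¹ := sub_pos.2 (inv_strictAnti₀ hσ₁ hσ)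
  refine le_of_sq_le_sq (le_of_mul_le_mul_right ?_ hinv) dist_nonneg
  linarith

theorem apply_le_apply (h₁ : IsProximal φ σ₁ w v₁) (h₂ : IsProximal φ σ₂ w v₂)
    (hbot : ∀ x, φ x ≠ ⊥) (hσ₁ : 0 < σ₁) (hσ : σ₁ < σ₂) (hw : φ w ≠ ⊤) : φ v₂ ≤ φ v₁ := by
  have hσ₂ : 0 < σ₂ := hσ₁.trans hσ
  have hv₁ := h₁.ne_top hσ₁ hw
  have hv₂ := h₂.ne_top hσ₂ hw
  have hle := h₂.proximalEnergy_le hbot hv₂ hv₁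
  have hdist : 1 / (2 * σ₂) * dist v₁ w ^ 2 ≤ 1 / (2 * σ₂) * dist v₂ w ^ 2 := by
    gcongr
    exact h₁.dist_le_dist h₂ hbot hσ₁ hσ hw
  rw [← EReal.coe_toReal hv₁ (hbot _), ← EReal.coe_toReal hv₂ (hbot _), EReal.coe_le_coe_iff]
  simp only [proximalEnergy] at hle
  linarith

theorem sub_le_mul_edist (h : IsProximal φ σ w v) (hbot : ∀ x, φ x ≠ ⊥) (hσ : 0 < σ)
    (hv : φ v ≠ ⊤) (y : X) :
    (φ v - φ y).toENNReal ≤ ENNReal.ofReal ((dist y w + dist v w) / (2 * σ)) * edist v y := by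
  by_cases hy : φ y = ⊤
  · simp [hy]
  have hle := h.proximalEnergy_le hbot hv hy
  have hdist : dist y w - dist v w ≤ dist v y := by
    linarith [dist_triangle y v w, dist_comm y v]
  rw [edist_dist, ← ENNReal.ofReal_mul (by positivity), ← EReal.coe_toReal hv (hbot v),
    ← EReal.coe_toReal hy (hbot y), ← EReal.coe_sub, EReal.real_coe_toENNReal]
  refine ENNReal.ofReal_le_ofReal ?_
  calc (φ v).toReal - (φ y).toReal
      ≤ (dist y w + dist v w) / (2 * σ) * (dist y w - dist v w) := by
        simp only [proximalEnergy] at hle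
        rw [← sub_nonneg] at hle ⊢
        exact hle.trans_eq (by ring)
    _ ≤ (dist y w + dist v w) / (2 * σ) * dist v y := by gcongr

theorem descendingSlope_le (h : IsProximal φ σ w v) (hbot : ∀ x, φ x ≠ ⊥) (hσ : 0 < σ)
    (hw : φ w ≠ ⊤) : descendingSlope φ v ≤ ENNReal.ofReal (dist v w / σ) := by
  have hv := h.ne_top hσ hw
  have hcont : Continuous fun y => ENNReal.ofReal ((dist y w + dist v w) / (2 * σ)) :=
    ENNReal.continuous_ofReal.comp (by fun_prop)
  refine (descendingSlope_le_of_sub_le hv hcont.continuousAt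
    (h.sub_le_mul_edist hbot hσ hv)).trans_eq ?_
  congr 1
  field_simp
  ring

end IsProximal

theorem sq_dist_le_of_coercive {v w uStar : X} {C e e₀ σ τStar : ℝ} (hσ : 0 < σ)
    (hστ : σ ≤ τStar / 4) (hC : C ≤ e + 1 / (2 * τStar) * dist v uStar ^ 2)
    (he : e + 1 / (2 * σ) * dist v w ^ 2 ≤ e₀) :
    dist v uStar ^ 2 ≤ 2 * τStar * (e₀ - C) + 4 * dist w uStar ^ 2 := by
  have hτ : 0 < τStar := by linarith
  have htri : dist v uStar ^ 2 ≤ 2 * dist v w ^ 2 + 2 * dist w uStar ^ 2 := by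
    have := pow_le_pow_left₀ dist_nonneg (dist_triangle v w uStar) 2
    nlinarith [sq_nonneg (dist v w - dist w uStar)]
  have hstep : 2 / τStar * dist v w ^ 2 ≤ 1 / (2 * σ) * dist v w ^ 2 := by
    gcongr ?_ * _
    rw [div_le_div_iff₀ hτ (by positivity)]
    linarith
  have hmul : τStar * (C + 2 / τStar * dist v w ^ 2) ≤
      τStar * (e₀ + 1 / (2 * τStar) * dist v uStar ^ 2) :=
    mul_le_mul_of_nonneg_left (by linarith) hτ.le
  field_simp at hmul
  linarith

theorem exists_isProximal {w uStar : X} {C σ τStar : ℝ} (hlsc : LowerSemicontinuous φ)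
    (hC : ∀ v : X, (C : EReal) ≤ φ v + ((1 / (2 * τStar) * dist v uStar ^ 2 : ℝ) : EReal))
    (hK : ∀ M > (0 : ℝ), ∃ K : Set X, IsCompact K ∧
      {u : X | dist u uStar ^ 2 ≤ M ∧ (φ u).abs ≤ ENNReal.ofReal M} ⊆ K)
    (hσ : 0 < σ) (hστ : σ ≤ τStar / 4) (hw : φ w ≠ ⊤) : ∃ v, IsProximal φ σ w v := by
  have hbot : ∀ x, φ x ≠ ⊥ := fun x => ne_bot_of_coe_le_add_coe (hC x)
  have hτ : 0 < τStar := by linarith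
  set R : ℝ := 2 * τStar * ((φ w).toReal - C) + 4 * dist w uStar ^ 2
  set m : ℝ := C - 1 / (2 * τStar) * R
  obtain ⟨K, hKc, hKM⟩ := hK (|R| + max |m| |(φ w).toReal| + 1) (by positivity)
  refine exists_isMinOn_univ_of_sublevel_subset (w := w) ?_ hKc fun v hv => ?_
  · refine hlsc.add' (Continuous.lowerSemicontinuous ?_) fun x =>
      EReal.continuousAt_add (Or.inr (EReal.coe_ne_bot _)) (Or.inl (hbot x))
    exact continuous_coe_real_ereal.comp (by fun_prop)
  · have hvw : φ v + ((1 / (2 * σ) * dist v w ^ 2 : ℝ) : EReal) ≤ φ w := by simpa using hv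
    have hv_top : φ v ≠ ⊤ := fun h => hw (top_le_iff.1 (by rwa [h, EReal.top_add_coe] at hvw))
    rw [← EReal.coe_toReal hv_top (hbot v), ← EReal.coe_toReal hw (hbot w), ← EReal.coe_add,
      EReal.coe_le_coe_iff] at hvw
    have hlow := le_toReal_add_of_coe_le_add_coe (hC v) hv_top
    have hR : dist v uStar ^ 2 ≤ R := sq_dist_le_of_coercive hσ hστ hlow hvw
    have hm : m ≤ (φ v).toReal := by
      have : 1 / (2 * τStar) * dist v uStar ^ 2 ≤ 1 / (2 * τStar) * R := by gcongr
      linarith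
    have hle : (φ v).toReal ≤ (φ w).toReal :=
      (le_add_of_nonneg_right (by positivity)).trans hvw
    refine hKM ⟨?_, ?_⟩
    · linarith [le_abs_self R, (abs_nonneg m).trans (le_max_left _ |(φ w).toReal|)]
    · rw [← EReal.coe_toReal hv_top (hbot v), EReal.abs_def]
      exact ENNReal.ofReal_le_ofReal (by linarith [abs_le_max_abs_abs hm hle, abs_nonneg R])

end Proximal

section Ceil

variable {τ σ s t : ℝ}

theorem le_ceil_div_mul (hτ : 0 < τ) (s : ℝ) : s ≤ (⌈s / τ⌉₊ : ℝ) * τ :=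
  (div_le_iff₀ hτ).1 (Nat.le_ceil _)

theorem ceil_div_mul_le (hτ : 0 < τ) (hs : 0 ≤ s) : (⌈s / τ⌉₊ : ℝ) * τ ≤ s + τ := by
  calc (⌈s / τ⌉₊ : ℝ) * τ ≤ (s / τ + 1) * τ := by
        gcongr
        exact (Nat.ceil_lt_add_one (div_nonneg hs hτ.le)).le
    _ = s + τ := by field_simp

theorem ceil_div_of_nonpos (hτ : 0 < τ) (hs : s ≤ 0) : ⌈s / τ⌉₊ = 0 :=
  Nat.ceil_eq_zero.2 (div_nonpos_of_nonpos_of_nonneg hs hτ.le)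

theorem ceil_div_mono (hτ : 0 < τ) : Monotone fun s : ℝ => ⌈s / τ⌉₊ :=
  fun _ _ hst => Nat.ceil_mono (div_le_div_of_nonneg_right hst hτ.le)

theorem ceil_div_sub_mul_le (hτ : 0 < τ) (hst : s ≤ t) :
    ((⌈t / τ⌉₊ : ℝ) - ⌈s / τ⌉₊) * τ ≤ t - s + τ := by
  rcases le_total 0 t with ht | ht
  · linarith [ceil_div_mul_le hτ ht, le_ceil_div_mul hτ s]
  · rw [ceil_div_of_nonpos hτ ht, ceil_div_of_nonpos hτ (hst.trans ht), sub_self, zero_mul]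
    linarith

theorem ceil_mul_add_div (i : ℕ) (hσ : 0 < σ) (hστ : σ ≤ τ) : ⌈(i * τ + σ) / τ⌉₊ = i + 1 := by
  have hτ : 0 < τ := hσ.trans_le hστ
  rw [Nat.ceil_eq_iff i.add_one_ne_zero, lt_div_iff₀ hτ, div_le_iff₀ hτ, Nat.add_sub_cancel]
  push_cast
  constructor <;> linarith

theorem exists_eq_mul_add (hτ : 0 < τ) (hs : 0 < s) :
    ∃ (i : ℕ) (σ : ℝ), 0 < σ ∧ σ ≤ τ ∧ s = i * τ + σ := by
  obtain ⟨i, hi⟩ := Nat.exists_eq_add_one.2 (Nat.ceil_pos.2 (div_pos hs hτ))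
  obtain ⟨hlt, hle⟩ := (Nat.ceil_eq_iff i.add_one_ne_zero).1 hi
  rw [lt_div_iff₀ hτ, Nat.add_sub_cancel] at hlt
  rw [div_le_iff₀ hτ, Nat.cast_succ] at hle
  exact ⟨i, s - i * τ, by linarith, by linarith, by ring⟩

end Ceil

noncomputable section DiscretePath

variable {X : Type*} [PseudoMetricSpace X]

/-- Length of the discrete path `w 0, …, w k`. -/
def pathLength (w : ℕ → X) (k : ℕ) : ℝ :=
  ∑ j ∈ Finset.range k, dist (w j) (w (j + 1))

/-- Action of the discrete path `w 0, …, w k` travelled with time step `τ`, the counterpart of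
`∫ |u'|²`. -/
def pathAction (τ : ℝ) (w : ℕ → X) (k : ℕ) : ℝ :=
  ∑ j ∈ Finset.range k, dist (w j) (w (j + 1)) ^ 2 / τ

variable {τ : ℝ} {i j : ℕ}

theorem pathLength_zero (w : ℕ → X) : pathLength w 0 = 0 :=
  Finset.sum_range_zero _

theorem pathAction_zero (τ : ℝ) (w : ℕ → X) : pathAction τ w 0 = 0 :=
  Finset.sum_range_zero _

theorem pathAction_succ (τ : ℝ) (w : ℕ → X) (k : ℕ) :
    pathAction τ w (k + 1) = pathAction τ w k + dist (w k) (w (k + 1)) ^ 2 / τ :=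
  Finset.sum_range_succ _ _

theorem pathLength_mono (w : ℕ → X) : Monotone (pathLength w) :=
  monotone_nat_of_le_succ fun k => by
    rw [pathLength, pathLength, Finset.sum_range_succ]
    exact le_add_of_nonneg_right dist_nonneg

theorem pathAction_mono (hτ : 0 < τ) (w : ℕ → X) : Monotone (pathAction τ w) :=
  monotone_nat_of_le_succ fun k => by
    rw [pathAction_succ]
    exact le_add_of_nonneg_right (by positivity)

theorem pathAction_nonneg (hτ : 0 < τ) (w : ℕ → X) (k : ℕ) : 0 ≤ pathAction τ w k :=
  (pathAction_zero τ w).symm.trans_le (pathAction_mono hτ w k.zero_le)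

theorem dist_le_pathLength_sub (w : ℕ → X) (hij : i ≤ j) :
    dist (w i) (w j) ≤ pathLength w j - pathLength w i :=
  (dist_le_Ico_sum_dist w hij).trans_eq (Finset.sum_Ico_eq_sub _ hij)

theorem sq_pathLength_sub_le (hτ : 0 < τ) (w : ℕ → X) (hij : i ≤ j) :
    (pathLength w j - pathLength w i) ^ 2 ≤
      ((j : ℝ) - i) * τ * (pathAction τ w j - pathAction τ w i) := by
  simp only [pathLength, pathAction]
  rw [← Finset.sum_Ico_eq_sub _ hij, ← Finset.sum_Ico_eq_sub _ hij, ← Finset.sum_div]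
  refine sq_sum_le_card_mul_sum_sq.trans_eq ?_
  rw [Nat.card_Ico, Nat.cast_sub hij]
  field_simp

theorem sq_dist_succ_le (hτ : 0 < τ) (w : ℕ → X) (k : ℕ) :
    dist (w k) (w (k + 1)) ^ 2 ≤ τ * pathAction τ w (k + 1) := by
  rw [pathAction_succ, mul_add, mul_div_cancel₀ _ hτ.ne']
  exact le_add_of_nonneg_left (mul_nonneg hτ.le (pathAction_nonneg hτ w k))

end DiscretePath

noncomputable section DeGiorgi

variable {X : Type*} [MetricSpace X]

/-- Energy of the node `w k` plus half of the action spent to reach it. -/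
def augmentedEnergy (φ : X → EReal) (τ : ℝ) (w : ℕ → X) (k : ℕ) : ℝ :=
  (φ (w k)).toReal + pathAction τ w k / 2

/-- De Giorgi's variational interpolation of the nodes `w i`, placed at the times `i * τ`: its value
at time `i * τ + σ` is obtained from `w i` by an implicit Euler step of length `σ`. -/
structure IsDeGiorgiInterpolation (φ : X → EReal) (τ : ℝ) (w : ℕ → X) (v : ℝ → X) : Prop where
  of_nonpos : ∀ t ≤ 0, v t = w 0
  node : ∀ i : ℕ, v (i * τ) = w i
  isProximal : ∀ (i : ℕ) (σ : ℝ), 0 < σ → σ ≤ τ → IsProximal φ σ (w i) (v (i * τ + σ))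

/-- Interpolation of `augmentedEnergy` along a De Giorgi interpolation `v`; the index
`⌈t / τ⌉₊ - 1` is the `i` with `t ∈ (i * τ, (i + 1) * τ]`. -/
def deGiorgiEnergy (φ : X → EReal) (τ : ℝ) (w : ℕ → X) (v : ℝ → X) (t : ℝ) : ℝ :=
  proximalEnergy φ (t - (⌈t / τ⌉₊ - 1 : ℕ) * τ) (w (⌈t / τ⌉₊ - 1)) (v t) +
    pathAction τ w (⌈t / τ⌉₊ - 1) / 2

variable {φ : X → EReal} {τ σ t : ℝ} {w : ℕ → X} {v : ℝ → X}

theorem deGiorgiEnergy_mul_add (i : ℕ) (hσ : 0 < σ) (hστ : σ ≤ τ) :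
    deGiorgiEnergy φ τ w v (i * τ + σ) =
      proximalEnergy φ σ (w i) (v (i * τ + σ)) + pathAction τ w i / 2 := by
  rw [deGiorgiEnergy, ceil_mul_add_div i hσ hστ, Nat.add_sub_cancel, add_sub_cancel_left]

theorem IsDiscreteScheme.exists_isDeGiorgiInterpolation {w₀ : X}
    (h : IsDiscreteScheme φ τ w₀ w) (hτ : 0 < τ)
    (hex : ∀ i : ℕ, ∀ σ, 0 < σ → σ < τ → ∃ x, IsProximal φ σ (w i) x) :
    ∃ v, IsDeGiorgiInterpolation φ τ w v := by
  have hstep : ∀ (i : ℕ) (σ : ℝ), ∃ x, (0 < σ → σ ≤ τ → IsProximal φ σ (w i) x) ∧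
      (σ = τ → x = w (i + 1)) := by
    intro i σ
    rcases eq_or_ne σ τ with rfl | hne
    · exact ⟨w (i + 1), fun _ _ => h.2 i, fun _ => rfl⟩
    by_cases hσ : 0 < σ ∧ σ < τ
    · obtain ⟨x, hx⟩ := hex i σ hσ.1 hσ.2
      exact ⟨x, fun _ _ => hx, fun heq => absurd heq hne⟩
    · exact ⟨w i, fun h0 hle => absurd ⟨h0, hle.lt_of_ne hne⟩ hσ, fun heq => absurd heq hne⟩
  choose J hJ hJτ using hstep
  set v : ℝ → X := fun t =>
    if t ≤ 0 then w 0 else J (⌈t / τ⌉₊ - 1) (t - (⌈t / τ⌉₊ - 1 : ℕ) * τ)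
  have hv : ∀ (i : ℕ) (σ : ℝ), 0 < σ → σ ≤ τ → v (i * τ + σ) = J i σ := by
    intro i σ hσ hστ
    simp only [v]
    rw [if_neg (not_le.2 (by positivity)), ceil_mul_add_div i hσ hστ, Nat.add_sub_cancel,
      add_sub_cancel_left]
  refine ⟨v, fun t ht => if_pos ht, fun i => ?_, fun i σ hσ hστ => ?_⟩
  · rcases i with _ | i
    · exact if_pos (by simp)
    · rw [Nat.cast_succ, add_one_mul, hv i τ hτ le_rfl, hJτ i τ rfl]
  · rw [hv i σ hσ hστ]
    exact hJ i σ hσ hστ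

namespace IsDeGiorgiInterpolation

theorem node_succ (hv : IsDeGiorgiInterpolation φ τ w v) (i : ℕ) :
    v (i * τ + τ) = w (i + 1) := by
  rw [← hv.node (i + 1), Nat.cast_succ, add_one_mul]

theorem isProximal_succ (hv : IsDeGiorgiInterpolation φ τ w v) (hτ : 0 < τ) (i : ℕ) :
    IsProximal φ τ (w i) (w (i + 1)) :=
  hv.node_succ i ▸ hv.isProximal i τ hτ le_rfl

theorem antitone_apply_node (hv : IsDeGiorgiInterpolation φ τ w v) (hτ : 0 < τ) :
    Antitone fun i => φ (w i) :=
  antitone_nat_of_succ_le fun i => (hv.isProximal_succ hτ i).le_self hτ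

theorem apply_node_ne_top (hv : IsDeGiorgiInterpolation φ τ w v) (hτ : 0 < τ) (h₀ : φ (w 0) ≠ ⊤)
    (i : ℕ) : φ (w i) ≠ ⊤ :=
  ne_top_of_le_ne_top h₀ (hv.antitone_apply_node hτ i.zero_le)

theorem proximalEnergy_add_half_pathAction (hv : IsDeGiorgiInterpolation φ τ w v) (hτ : 0 < τ)
    (i : ℕ) :
    proximalEnergy φ τ (w i) (v (i * τ + τ)) + pathAction τ w i / 2 =
      augmentedEnergy φ τ w (i + 1) := by
  rw [hv.node_succ, augmentedEnergy, pathAction_succ, proximalEnergy, dist_comm (w i)]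
  field_simp
  ring

theorem deGiorgiEnergy_of_nonpos (hv : IsDeGiorgiInterpolation φ τ w v) (hτ : 0 < τ)
    (ht : t ≤ 0) : deGiorgiEnergy φ τ w v t = augmentedEnergy φ τ w 0 := by
  rw [deGiorgiEnergy, ceil_div_of_nonpos hτ ht, Nat.zero_sub, hv.of_nonpos t ht,
    proximalEnergy_self, augmentedEnergy]

theorem deGiorgiEnergy_node (hv : IsDeGiorgiInterpolation φ τ w v) (hτ : 0 < τ) (k : ℕ) :
    deGiorgiEnergy φ τ w v (k * τ) = augmentedEnergy φ τ w k := by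
  rcases k with _ | i
  · exact hv.deGiorgiEnergy_of_nonpos hτ (by simp)
  · rw [Nat.cast_succ, add_one_mul, deGiorgiEnergy_mul_add i hτ le_rfl,
      hv.proximalEnergy_add_half_pathAction hτ]

theorem augmentedEnergy_succ_le (hv : IsDeGiorgiInterpolation φ τ w v) (hbot : ∀ x, φ x ≠ ⊥)
    (h₀ : φ (w 0) ≠ ⊤) (i : ℕ) (hσ : 0 < σ) (hστ : σ ≤ τ) :
    augmentedEnergy φ τ w (i + 1) ≤ deGiorgiEnergy φ τ w v (i * τ + σ) := by
  have hτ : 0 < τ := hσ.trans_le hστ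
  rw [← hv.proximalEnergy_add_half_pathAction hτ, deGiorgiEnergy_mul_add i hσ hστ]
  gcongr
  exact (hv.isProximal i σ hσ hστ).proximalEnergy_anti (hv.isProximal i τ hτ le_rfl) hbot hσ hστ
    (hv.apply_node_ne_top hτ h₀ i)

theorem deGiorgiEnergy_le (hv : IsDeGiorgiInterpolation φ τ w v) (hbot : ∀ x, φ x ≠ ⊥)
    (h₀ : φ (w 0) ≠ ⊤) (i : ℕ) (hσ : 0 < σ) (hστ : σ ≤ τ) :
    deGiorgiEnergy φ τ w v (i * τ + σ) ≤ augmentedEnergy φ τ w i := by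
  rw [deGiorgiEnergy_mul_add i hσ hστ, augmentedEnergy]
  gcongr
  exact (hv.isProximal i σ hσ hστ).proximalEnergy_le_self hbot hσ
    (hv.apply_node_ne_top (hσ.trans_le hστ) h₀ i)

theorem antitone_augmentedEnergy (hv : IsDeGiorgiInterpolation φ τ w v) (hτ : 0 < τ)
    (hbot : ∀ x, φ x ≠ ⊥) (h₀ : φ (w 0) ≠ ⊤) : Antitone (augmentedEnergy φ τ w) :=
  antitone_nat_of_succ_le fun i => (hv.augmentedEnergy_succ_le hbot h₀ i hτ le_rfl).trans
    (hv.deGiorgiEnergy_le hbot h₀ i hτ le_rfl)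

theorem antitone_deGiorgiEnergy (hv : IsDeGiorgiInterpolation φ τ w v) (hτ : 0 < τ)
    (hbot : ∀ x, φ x ≠ ⊥) (h₀ : φ (w 0) ≠ ⊤) : Antitone (deGiorgiEnergy φ τ w v) := by
  have hnode := hv.antitone_augmentedEnergy hτ hbot h₀
  intro s t hst
  rcases le_or_gt t 0 with ht | ht
  · rw [hv.deGiorgiEnergy_of_nonpos hτ ht, hv.deGiorgiEnergy_of_nonpos hτ (hst.trans ht)]
  obtain ⟨j, ρ, hρ, hρτ, rfl⟩ := exists_eq_mul_add hτ ht
  rcases le_or_gt s 0 with hs | hs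
  · rw [hv.deGiorgiEnergy_of_nonpos hτ hs]
    exact (hv.deGiorgiEnergy_le hbot h₀ j hρ hρτ).trans (hnode j.zero_le)
  obtain ⟨i, σ, hσ, hστ, rfl⟩ := exists_eq_mul_add hτ hs
  have hij : i ≤ j := by
    simpa only [ceil_mul_add_div _ hσ hστ, ceil_mul_add_div _ hρ hρτ, add_le_add_iff_right]
      using ceil_div_mono hτ hst
  rcases hij.eq_or_lt with rfl | hij
  · rw [deGiorgiEnergy_mul_add i hσ hστ, deGiorgiEnergy_mul_add i hρ hρτ]
    gcongr
    exact (hv.isProximal i σ hσ hστ).proximalEnergy_anti (hv.isProximal i ρ hρ hρτ) hbot hσ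
      (by linarith) (hv.apply_node_ne_top hτ h₀ i)
  · exact ((hv.deGiorgiEnergy_le hbot h₀ j hρ hρτ).trans (hnode hij)).trans
      (hv.augmentedEnergy_succ_le hbot h₀ i hσ hστ)

/- On `(i * τ, (i + 1) * τ)`, minimality of `v s` gives
`Θ r - Θ s ≥ d² / 2 * ((r - i * τ)⁻¹ - (s - i * τ)⁻¹)` for `r ≤ s`, where `Θ` is the interpolated
energy and `d` the distance of `v r` from `w i`. -/
theorem sq_div_le_neg_deriv (hv : IsDeGiorgiInterpolation φ τ w v) (hbot : ∀ x, φ x ≠ ⊥)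
    (h₀ : φ (w 0) ≠ ⊤) (i : ℕ) (hσ : 0 < σ) (hστ : σ < τ)
    (hΘ : DifferentiableAt ℝ (deGiorgiEnergy φ τ w v) (i * τ + σ)) :
    (dist (v (i * τ + σ)) (w i) / σ) ^ 2 ≤ -2 * deriv (deGiorgiEnergy φ τ w v) (i * τ + σ) := by
  set d := dist (v (i * τ + σ)) (w i)
  have hinv : HasDerivAt (fun s => -(d ^ 2 / 2 * (s - i * τ)⁻¹)) ((d / σ) ^ 2 / 2) (i * τ + σ) := by
    have hsub : (i * τ + σ) - i * τ = σ := add_sub_cancel_left _ _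
    have hsub' : HasDerivAt (fun s => s - i * τ) 1 (i * τ + σ) := (hasDerivAt_id _).sub_const _
    refine ((hsub'.fun_inv (hsub.trans_ne hσ.ne')).const_mul (d ^ 2 / 2)).fun_neg.congr_deriv ?_
    rw [hsub]
    ring
  have hle : (d / σ) ^ 2 / 2 ≤ -deriv (deGiorgiEnergy φ τ w v) (i * τ + σ) := by
    refine hasDerivAt_le_of_frequently_sub_le hinv hΘ.hasDerivAt.neg (Eventually.frequently ?_)
    filter_upwards [Ioo_mem_nhdsGT (show i * τ + σ < i * τ + τ by linarith)] with s hs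
    obtain ⟨ρ, rfl⟩ : ∃ ρ, s = i * τ + ρ := ⟨s - i * τ, by ring⟩
    have hσρ : σ < ρ := by linarith [hs.1]
    have hρτ : ρ ≤ τ := by linarith [hs.2]
    have hdiff := (hv.isProximal i σ hσ hστ.le).mul_inv_sub_inv_le
      (hv.isProximal i ρ (hσ.trans hσρ) hρτ) hbot hσ (hσ.trans hσρ)
      (hv.apply_node_ne_top (hσ.trans hστ) h₀ i)
    simp only [Pi.neg_apply, add_sub_cancel_left, deGiorgiEnergy_mul_add i hσ hστ.le,
      deGiorgiEnergy_mul_add i (hσ.trans hσρ) hρτ]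
    linarith
  linarith

theorem ae_sq_descendingSlope_le (hv : IsDeGiorgiInterpolation φ τ w v) (hτ : 0 < τ)
    (hbot : ∀ x, φ x ≠ ⊥) (h₀ : φ (w 0) ≠ ⊤) : ∀ᵐ t, 0 < t →
      descendingSlope φ (v t) ^ 2 ≤ ENNReal.ofReal (-2 * deriv (deGiorgiEnergy φ τ w v) t) := by
  have hgrid : ∀ᵐ t : ℝ, t ∉ range fun k : ℕ => (k : ℝ) * τ :=
    (countable_range _).ae_notMem volume
  filter_upwards [ae_differentiableAt_of_antitone (hv.antitone_deGiorgiEnergy hτ hbot h₀), hgrid]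
    with t hΘ hgrid ht
  obtain ⟨i, σ, hσ, hστ, rfl⟩ := exists_eq_mul_add hτ ht
  have hne : σ ≠ τ := by
    rintro rfl
    exact hgrid ⟨i + 1, by push_cast; ring⟩
  calc _ ≤ ENNReal.ofReal (dist (v (i * τ + σ)) (w i) / σ) ^ 2 := by
        gcongr
        exact (hv.isProximal i σ hσ hστ).descendingSlope_le hbot hσ (hv.apply_node_ne_top hτ h₀ i)
    _ = ENNReal.ofReal ((dist (v (i * τ + σ)) (w i) / σ) ^ 2) :=
        (ENNReal.ofReal_pow (by positivity) 2).symm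
    _ ≤ _ := ENNReal.ofReal_le_ofReal
        (hv.sq_div_le_neg_deriv hbot h₀ i hσ (hστ.lt_of_ne hne) hΘ)

theorem apply_piecewiseConstant_le (hv : IsDeGiorgiInterpolation φ τ w v) (hτ : 0 < τ)
    (hbot : ∀ x, φ x ≠ ⊥) (h₀ : φ (w 0) ≠ ⊤) (ht : 0 < t) :
    φ (piecewiseConstant τ w t) ≤ φ (v t) := by
  obtain ⟨i, σ, hσ, hστ, rfl⟩ := exists_eq_mul_add hτ ht
  rw [piecewiseConstant, ceil_mul_add_div i hσ hστ]
  rcases hστ.eq_or_lt with rfl | hlt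
  · rw [hv.node_succ]
  · exact (hv.isProximal i σ hσ hστ).apply_le_apply (hv.isProximal_succ hτ i) hbot hσ hlt
      (hv.apply_node_ne_top hτ h₀ i)

theorem apply_le_piecewiseConstant_sub (hv : IsDeGiorgiInterpolation φ τ w v) (hτ : 0 < τ)
    (ht : 0 < t) : φ (v t) ≤ φ (piecewiseConstant τ w (t - τ)) := by
  obtain ⟨i, σ, hσ, hστ, rfl⟩ := exists_eq_mul_add hτ ht
  rw [piecewiseConstant, sub_div, div_self hτ.ne', Nat.ceil_sub_one, ceil_mul_add_div i hσ hστ,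
    Nat.add_sub_cancel]
  exact (hv.isProximal i σ hσ hστ).le_self hσ

theorem sq_dist_piecewiseConstant_le (hv : IsDeGiorgiInterpolation φ τ w v) (hτ : 0 < τ)
    (hbot : ∀ x, φ x ≠ ⊥) (h₀ : φ (w 0) ≠ ⊤) (ht : 0 < t) :
    dist (piecewiseConstant τ w t) (v t) ^ 2 ≤ 4 * τ * pathAction τ w ⌈t / τ⌉₊ := by
  obtain ⟨i, σ, hσ, hστ, rfl⟩ := exists_eq_mul_add hτ ht
  rw [piecewiseConstant, ceil_mul_add_div i hσ hστ]
  have hstep := sq_dist_succ_le hτ w i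
  have hdist : dist (w (i + 1)) (v (i * τ + σ)) ≤ 2 * dist (w i) (w (i + 1)) := by
    rcases hστ.eq_or_lt with rfl | hlt
    · simp [hv.node_succ]
    · have hle := (hv.isProximal i σ hσ hστ).dist_le_dist (hv.isProximal_succ hτ i) hbot hσ hlt
        (hv.apply_node_ne_top hτ h₀ i)
      rw [dist_comm (w (i + 1)) (w i)] at hle
      linarith [dist_triangle (w (i + 1)) (w i) (v (i * τ + σ)), dist_comm (w (i + 1)) (w i),
        dist_comm (w i) (v (i * τ + σ))]
  calc _ ≤ (2 * dist (w i) (w (i + 1))) ^ 2 := by gcongr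
    _ ≤ _ := by linarith

theorem lintegral_neg_deriv_le (hv : IsDeGiorgiInterpolation φ τ w v) (hτ : 0 < τ)
    (hbot : ∀ x, φ x ≠ ⊥) (h₀ : φ (w 0) ≠ ⊤) {i j : ℕ} (hij : i ≤ j) :
    ∫⁻ r in Ioo (i * τ) (j * τ), ENNReal.ofReal (-2 * deriv (deGiorgiEnergy φ τ w v) r) ≤
      ENNReal.ofReal (2 * (augmentedEnergy φ τ w i - augmentedEnergy φ τ w j)) := by
  have hanti := hv.antitone_deGiorgiEnergy hτ hbot h₀
  have hmono : Monotone fun r => -2 * deGiorgiEnergy φ τ w v r := fun s t hst => by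
    linarith [hanti hst]
  have hle := lintegral_deriv_le_of_monotone hmono (mul_le_mul_of_nonneg_right
    (Nat.cast_le.2 hij) hτ.le)
  simp only [deriv_const_mul_field, hv.deGiorgiEnergy_node hτ] at hle
  exact hle.trans_eq (by ring_nf)

theorem hasDissipationBound (hv : IsDeGiorgiInterpolation φ τ w v) (hτ : 0 < τ)
    (hbot : ∀ x, φ x ≠ ⊥) (h₀ : φ (w 0) ≠ ⊤) :
    HasDissipationBound τ (piecewiseConstant τ w)
      (fun t => (φ (piecewiseConstant τ w t)).toReal) (fun t => pathAction τ w ⌈t / τ⌉₊)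
      (fun t => pathLength w ⌈t / τ⌉₊)
      (fun r => ENNReal.ofReal (-2 * deriv (deGiorgiEnergy φ τ w v) r)) where
  antitone_energy s t hst := EReal.toReal_le_toReal
    (hv.antitone_apply_node hτ (ceil_div_mono hτ hst)) (hbot _) (hv.apply_node_ne_top hτ h₀ _)
  monotone_action := (pathAction_mono hτ w).comp (ceil_div_mono hτ)
  monotone_length := (pathLength_mono w).comp (ceil_div_mono hτ)
  action_eq_zero t ht := by rw [ceil_div_of_nonpos hτ ht, pathAction_zero]
  length_eq_zero t ht := by rw [ceil_div_of_nonpos hτ ht, pathLength_zero]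
  dist_le s t _ hst := dist_le_pathLength_sub w (ceil_div_mono hτ hst)
  sq_length_le s t hst := (sq_pathLength_sub_le hτ w (ceil_div_mono hτ hst)).trans
    (mul_le_mul_of_nonneg_right (ceil_div_sub_mul_le hτ hst)
      (sub_nonneg.2 (pathAction_mono hτ w (ceil_div_mono hτ hst))))
  action_le s t hst := by
    have hle := hv.antitone_augmentedEnergy hτ hbot h₀ (ceil_div_mono hτ hst)
    simp only [augmentedEnergy] at hle
    simp only [piecewiseConstant]
    linarith
  measurable := ((measurable_deriv _).const_mul (-2)).ennreal_ofReal
  lintegral_le s t hs hst := by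
    refine (lintegral_mono_set (Ioo_subset_Ioo (ceil_div_mul_le hτ hs)
      (le_ceil_div_mul hτ t))).trans ((hv.lintegral_neg_deriv_le hτ hbot h₀
        (ceil_div_mono hτ hst)).trans_eq ?_)
    simp only [augmentedEnergy, piecewiseConstant]
    ring_nf

end IsDeGiorgiInterpolation

end DeGiorgi

namespace HasDissipationBound

section ActionBound

variable {X : Type*} [MetricSpace X] {τ : ℝ} {u : ℝ → X} {E V F : ℝ → ℝ} {H : ℝ → ℝ≥0∞}

theorem abs_action_le (h : HasDissipationBound τ u E V F H) (t : ℝ) :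
    |V t| ≤ 2 * (E (min t 0) - E t) := by
  have hV := h.monotone_action (min_le_left t 0)
  have hE := h.action_le _ _ (min_le_left t 0)
  rw [h.action_eq_zero _ (min_le_right t 0)] at hV hE
  rwa [abs_of_nonneg hV, ← sub_zero (V t)]

theorem sq_length_le_mul_action (h : HasDissipationBound τ u E V F H) (t : ℝ) :
    F t ^ 2 ≤ (t - min t 0 + τ) * V t := by
  simpa only [h.action_eq_zero _ (min_le_right t 0), h.length_eq_zero _ (min_le_right t 0),
    sub_zero] using h.sq_length_le _ _ (min_le_left t 0)

end ActionBound

section Limit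

variable {X : Type*} [MetricSpace X] {τ : ℕ → ℝ} {u : ℕ → ℝ → X} {E V F : ℕ → ℝ → ℝ}
  {H : ℕ → ℝ → ℝ≥0∞} {u' : ℝ → X} {E' V' F' : ℝ → ℝ}

theorem exists_subseq_tendsto (h : ∀ n, HasDissipationBound (τ n) (u n) (E n) (V n) (F n) (H n))
    (hτ : Tendsto τ atTop (𝓝 0)) (hE : ∀ t, ∃ B, ∀ᶠ n in atTop, |E n t| ≤ B) :
    ∃ k : ℕ → ℕ, StrictMono k ∧ ∃ E' V' F' : ℝ → ℝ,
      (∀ t, Tendsto (fun n => E (k n) t) atTop (𝓝 (E' t))) ∧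
      (∀ t, Tendsto (fun n => V (k n) t) atTop (𝓝 (V' t))) ∧
      ∀ t, Tendsto (fun n => F (k n) t) atTop (𝓝 (F' t)) := by
  have hV : ∀ t, ∃ B, ∀ᶠ n in atTop, |V n t| ≤ B := by
    intro t
    obtain ⟨B₀, hB₀⟩ := hE (min t 0)
    obtain ⟨B, hB⟩ := hE t
    refine ⟨2 * (B₀ + B), ?_⟩
    filter_upwards [hB₀, hB] with n hn₀ hn
    linarith [(h n).abs_action_le t, (abs_le.1 hn₀).2, (abs_le.1 hn).1]
  have hF : ∀ t, ∃ B, ∀ᶠ n in atTop, |F n t| ≤ B := by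
    intro t
    obtain ⟨B, hB⟩ := hV t
    refine ⟨√((t - min t 0 + 1) * B), ?_⟩
    filter_upwards [hB, hτ.eventually_le_const zero_lt_one] with n hn hτn
    refine Real.abs_le_sqrt (((h n).sq_length_le_mul_action t).trans ?_)
    have hVn : 0 ≤ V n t := by
      rw [← (h n).action_eq_zero _ (min_le_right t 0)]
      exact (h n).monotone_action (min_le_left t 0)
    have ht : 0 ≤ t - min t 0 := sub_nonneg.2 (min_le_left t 0)
    gcongr
    exact (abs_le.1 hn).2
  obtain ⟨k₁, hk₁, E', hE'⟩ := exists_subseq_tendsto_of_monotone_of_bounded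
    (f := fun n t => -E n t) (fun n => (h n).antitone_energy.neg) (by simpa only [abs_neg] using hE)
  obtain ⟨k₂, hk₂, V', hV'⟩ := exists_subseq_tendsto_of_monotone_of_bounded
    (fun n => (h (k₁ n)).monotone_action)
    fun t => (hV t).imp fun B hB => hk₁.tendsto_atTop.eventually hB
  obtain ⟨k₃, hk₃, F', hF'⟩ := exists_subseq_tendsto_of_monotone_of_bounded
    (fun n => (h (k₁ (k₂ n))).monotone_length)
    fun t => (hF t).imp fun B hB => (hk₁.comp hk₂).tendsto_atTop.eventually hB
  refine ⟨fun n => k₁ (k₂ (k₃ n)), hk₁.comp (hk₂.comp hk₃), fun t => -E' t, V', F', fun t => ?_,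
    fun t => (hV' t).comp hk₃.tendsto_atTop, hF'⟩
  simpa only [neg_neg, Function.comp_def] using ((hE' t).comp (hk₂.comp hk₃).tendsto_atTop).neg

theorem lintegral_liminf_le_of_tendsto
    (h : ∀ n, HasDissipationBound (τ n) (u n) (E n) (V n) (F n) (H n))
    (hτ : Tendsto τ atTop (𝓝 0)) (hE : ∀ t, Tendsto (fun n => E n t) atTop (𝓝 (E' t)))
    (hV : ∀ t, Tendsto (fun n => V n t) atTop (𝓝 (V' t))) {s t : ℝ} (hs : 0 ≤ s) (hst : s ≤ t) :
    ∫⁻ r in Ioo s t, liminf (fun n => H n r) atTop ≤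
      ENNReal.ofReal (2 * (E' s - E' t) - (V' t - V' s)) := by
  set I : ℕ → Set ℝ := fun n => Ioo (s + τ n) t
  have hI : ∀ r ∈ Ioo s t, liminf (fun n => H n r) atTop =
      liminf (fun n => (I n).indicator (H n) r) atTop := by
    intro r hr
    refine liminf_congr ?_
    filter_upwards [hτ.eventually_lt_const (sub_pos.2 hr.1)] with n hn
    have hr' : r ∈ I n := ⟨by linarith, hr.2⟩
    exact (indicator_of_mem hr' (H n)).symm
  have hlim : Tendsto (fun n => ENNReal.ofReal (2 * (E n s - E n t) - (V n t - V n s))) atTop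
      (𝓝 (ENNReal.ofReal (2 * (E' s - E' t) - (V' t - V' s)))) :=
    ENNReal.tendsto_ofReal ((((hE s).sub (hE t)).const_mul 2).sub ((hV t).sub (hV s)))
  calc _ = ∫⁻ r in Ioo s t, liminf (fun n => (I n).indicator (H n) r) atTop :=
        setLIntegral_congr_fun measurableSet_Ioo hI
    _ ≤ ∫⁻ r, liminf (fun n => (I n).indicator (H n) r) atTop := setLIntegral_le_lintegral _ _
    _ ≤ liminf (fun n => ∫⁻ r, (I n).indicator (H n) r) atTop :=
        lintegral_liminf_le fun n => (h n).measurable.indicator measurableSet_Ioo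
    _ ≤ liminf (fun n => ENNReal.ofReal (2 * (E n s - E n t) - (V n t - V n s))) atTop := by
        refine liminf_le_liminf (Eventually.of_forall fun n => ?_)
        rw [lintegral_indicator measurableSet_Ioo]
        exact (h n).lintegral_le s t hs hst
    _ = _ := hlim.liminf_eq

theorem of_tendsto (h : ∀ n, HasDissipationBound (τ n) (u n) (E n) (V n) (F n) (H n))
    (hτ : Tendsto τ atTop (𝓝 0)) (hu : ∀ t, 0 ≤ t → Tendsto (fun n => u n t) atTop (𝓝 (u' t)))
    (hE : ∀ t, Tendsto (fun n => E n t) atTop (𝓝 (E' t)))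
    (hV : ∀ t, Tendsto (fun n => V n t) atTop (𝓝 (V' t)))
    (hF : ∀ t, Tendsto (fun n => F n t) atTop (𝓝 (F' t))) :
    HasDissipationBound 0 u' E' V' F' fun r => liminf (fun n => H n r) atTop where
  antitone_energy s t hst :=
    le_of_tendsto_of_tendsto' (hE t) (hE s) fun n => (h n).antitone_energy hst
  monotone_action s t hst :=
    le_of_tendsto_of_tendsto' (hV s) (hV t) fun n => (h n).monotone_action hst
  monotone_length s t hst :=
    le_of_tendsto_of_tendsto' (hF s) (hF t) fun n => (h n).monotone_length hst
  action_eq_zero t ht := tendsto_nhds_unique (hV t)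
    (tendsto_const_nhds.congr fun n => ((h n).action_eq_zero t ht).symm)
  length_eq_zero t ht := tendsto_nhds_unique (hF t)
    (tendsto_const_nhds.congr fun n => ((h n).length_eq_zero t ht).symm)
  dist_le s t hs hst := le_of_tendsto_of_tendsto' ((hu s hs).dist (hu t (hs.trans hst)))
    ((hF t).sub (hF s)) fun n => (h n).dist_le s t hs hst
  sq_length_le s t hst := le_of_tendsto_of_tendsto' (((hF t).sub (hF s)).pow 2)
    ((hτ.const_add (t - s)).mul ((hV t).sub (hV s))) fun n => (h n).sq_length_le s t hst
  action_le s t hst := le_of_tendsto_of_tendsto' ((hV t).sub (hV s))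
    (((hE s).sub (hE t)).const_mul 2) fun n => (h n).action_le s t hst
  measurable := .liminf fun n => (h n).measurable
  lintegral_le s t hs hst := by
    simpa only [add_zero] using lintegral_liminf_le_of_tendsto h hτ hE hV hs hst

end Limit

end HasDissipationBound

theorem eventually_abs_le_of_tendsto_coe {ι : Type*} {l : Filter ι} {a : ι → EReal} {e : ℝ}
    (h : Tendsto a l (𝓝 (e : EReal))) : ∀ᶠ i in l, (a i).abs ≤ ENNReal.ofReal (|e| + 1) := by
  have hreal : Tendsto (fun i => |(a i).toReal|) l (𝓝 |e|) :=
    ((EReal.tendsto_toReal (EReal.coe_ne_top e) (EReal.coe_ne_bot e)).comp h).abs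
  filter_upwards [h.eventually (Ioo_mem_nhds (EReal.bot_lt_coe e) (EReal.coe_lt_top e)),
    hreal.eventually_le_const (lt_add_one |e|)] with i hfin hle
  rw [← EReal.coe_toReal hfin.2.ne hfin.1.ne', EReal.abs_def]
  exact ENNReal.ofReal_le_ofReal hle

theorem ConditionH.apply_eq_and_descendingSlope_le {X : Type*} [MetricSpace X]
    {φε : ℝ → X → EReal} {φ : X → EReal} {ε : ℕ → ℝ} {v : ℕ → X} {x : X} {e : ℝ}
    (hH : ConditionH φε φ) (hε : ∀ n, 0 < ε n) (hε₀ : Tendsto ε atTop (𝓝 0))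
    (hv : Tendsto v atTop (𝓝 x))
    (he : Tendsto (fun n => φε (ε n) (v n)) atTop (𝓝 (e : EReal)))
    (hfin : liminf (fun n => descendingSlope (φε (ε n)) (v n)) atTop ≠ ⊤) :
    φ x = (e : EReal) ∧
      descendingSlope φ x ≤ liminf (fun n => descendingSlope (φε (ε n)) (v n)) atTop := by
  have hsub : ∀ c ≠ ⊤, liminf (fun n => descendingSlope (φε (ε n)) (v n)) atTop < c →
      φ x = (e : EReal) ∧ descendingSlope φ x ≤ c := by
    intro c hc hlt
    obtain ⟨k, hk, hkc⟩ := extraction_of_frequently_atTop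
      ((frequently_lt_of_liminf_lt (by isBoundedDefault) hlt).and_eventually
        (eventually_abs_le_of_tendsto_coe he))
    obtain ⟨henergy, hslope⟩ := hH (ε ∘ k) (v ∘ k) x (fun n => hε _) (hε₀.comp hk.tendsto_atTop)
      (hv.comp hk.tendsto_atTop) ((iSup_le fun n => add_le_add (hkc n).2 (hkc n).1.le).trans_lt
        (ENNReal.add_lt_top.2 ⟨ENNReal.ofReal_lt_top, hc.lt_top⟩))
    exact ⟨tendsto_nhds_unique henergy (he.comp hk.tendsto_atTop),
      hslope.trans (liminf_le_of_frequently_le' (Frequently.of_forall fun n => (hkc n).1.le))⟩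
  obtain ⟨b, hb, hb_top⟩ := exists_between hfin.lt_top
  refine ⟨(hsub b hb_top.ne hb).1, le_of_forall_gt_imp_ge_of_dense fun c hc => ?_⟩
  rcases eq_or_ne c ⊤ with rfl | hc_top
  · exact le_top
  · exact (hsub c hc_top hc).2

theorem ConditionH.apply_eq_and_sq_descendingSlope_le {X : Type*} [MetricSpace X]
    {φε : ℝ → X → EReal} {φ : X → EReal} {ε : ℕ → ℝ} {v : ℕ → X} {x : X} {e : ℝ} {h : ℕ → ℝ≥0∞}
    (hH : ConditionH φε φ) (hε : ∀ n, 0 < ε n) (hε₀ : Tendsto ε atTop (𝓝 0))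
    (hv : Tendsto v atTop (𝓝 x))
    (he : Tendsto (fun n => φε (ε n) (v n)) atTop (𝓝 (e : EReal)))
    (hh : ∀ n, descendingSlope (φε (ε n)) (v n) ^ 2 ≤ h n) (hfin : liminf h atTop ≠ ⊤) :
    φ x = (e : EReal) ∧ descendingSlope φ x ^ 2 ≤ liminf h atTop := by
  have hsq : (liminf (fun n => descendingSlope (φε (ε n)) (v n)) atTop) ^ 2 ≤ liminf h atTop := by
    rw [Monotone.map_liminf_of_continuousAt (f := fun a : ℝ≥0∞ => a ^ 2)
      (fun a b hab => pow_le_pow_left₀ zero_le hab 2) _ (ENNReal.continuous_pow 2).continuousAt]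
    exact liminf_le_liminf (Eventually.of_forall hh)
  have hfin' : liminf (fun n => descendingSlope (φε (ε n)) (v n)) atTop ≠ ⊤ := fun htop =>
    hfin (top_le_iff.1 (by rwa [htop, ENNReal.top_pow two_ne_zero] at hsq))
  obtain ⟨henergy, hslope⟩ := hH.apply_eq_and_descendingSlope_le hε hε₀ hv he hfin'
  exact ⟨henergy, (pow_le_pow_left₀ zero_le hslope 2).trans hsq⟩

section Convergence

variable {X : Type*} [MetricSpace X] {φ : ℕ → X → EReal} {τ : ℕ → ℝ} {w : ℕ → ℕ → X}
  {v : ℕ → ℝ → X} {E : ℝ → ℝ} {t : ℝ}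

theorem IsDeGiorgiInterpolation.tendsto_of_tendsto_piecewiseConstant {x : X} {a : ℝ}
    (hv : ∀ n, IsDeGiorgiInterpolation (φ n) (τ n) (w n) (v n)) (hτ : ∀ n, 0 < τ n)
    (hτ₀ : Tendsto τ atTop (𝓝 0)) (hbot : ∀ n x, φ n x ≠ ⊥) (h₀ : ∀ n, φ n (w n 0) ≠ ⊤)
    (ht : 0 < t) (hx : Tendsto (fun n => piecewiseConstant (τ n) (w n) t) atTop (𝓝 x))
    (ha : Tendsto (fun n => pathAction (τ n) (w n) ⌈t / τ n⌉₊) atTop (𝓝 a)) :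
    Tendsto (fun n => v n t) atTop (𝓝 x) := by
  have hsq : Tendsto (fun n => 4 * τ n * pathAction (τ n) (w n) ⌈t / τ n⌉₊) atTop (𝓝 0) := by
    simpa only [mul_zero, zero_mul] using (hτ₀.const_mul 4).mul ha
  have hsqrt := (Real.continuous_sqrt.tendsto 0).comp hsq
  rw [Real.sqrt_zero] at hsqrt
  refine tendsto_of_tendsto_of_dist hx (squeeze_zero (fun _ => dist_nonneg) (fun n => ?_) hsqrt)
  exact Real.le_sqrt_of_sq_le
    ((hv n).sq_dist_piecewiseConstant_le (hτ n) (hbot n) (h₀ n) ht)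

/- The energy of `v n t` lies between those of the scheme at the times `t` and `t - τ n`. -/
theorem IsDeGiorgiInterpolation.tendsto_apply_of_tendsto_piecewiseConstant
    (hv : ∀ n, IsDeGiorgiInterpolation (φ n) (τ n) (w n) (v n)) (hτ : ∀ n, 0 < τ n)
    (hτ₀ : Tendsto τ atTop (𝓝 0)) (hbot : ∀ n x, φ n x ≠ ⊥) (h₀ : ∀ n, φ n (w n 0) ≠ ⊤)
    (hE : ∀ t, Tendsto (fun n => (φ n (piecewiseConstant (τ n) (w n) t)).toReal) atTop (𝓝 (E t)))
    (hEt : ContinuousAt E t) (ht : 0 < t) :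
    Tendsto (fun n => φ n (v n t)) atTop (𝓝 (E t : EReal)) := by
  have hcoe : ∀ n s, ((φ n (piecewiseConstant (τ n) (w n) s)).toReal : EReal) =
      φ n (piecewiseConstant (τ n) (w n) s) := fun n s =>
    EReal.coe_toReal ((hv n).apply_node_ne_top (hτ n) (h₀ n) _) (hbot n _)
  have hlag : Tendsto (fun n => (φ n (piecewiseConstant (τ n) (w n) (t - τ n))).toReal) atTop
      (𝓝 (E t)) := by
    have hmono : ∀ n, Monotone fun s => -(φ n (piecewiseConstant (τ n) (w n) s)).toReal :=
      fun n => ((hv n).hasDissipationBound (hτ n) (hbot n) (h₀ n)).antitone_energy.neg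
    simpa only [neg_neg] using (tendsto_apply_of_monotone_of_tendsto_on_dense hmono dense_univ
      (fun s _ => (hE s).neg) hEt.neg (by simpa only [sub_zero] using hτ₀.const_sub t)).neg
  have hlow := (continuous_coe_real_ereal.tendsto _).comp (hE t)
  have hupp := (continuous_coe_real_ereal.tendsto _).comp hlag
  simp only [Function.comp_def, hcoe] at hlow hupp
  exact tendsto_of_tendsto_of_tendsto_of_le_of_le hlow hupp
    (fun n => (hv n).apply_piecewiseConstant_le (hτ n) (hbot n) (h₀ n) ht)
    (fun n => (hv n).apply_le_piecewiseConstant_sub (hτ n) ht)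

theorem exists_eventually_abs_toReal_le {x : ℕ → X} {y uStar : X} {C S τStar : ℝ}
    (hC : ∀ n v, (C : EReal) ≤ φ n v + ((1 / (2 * τStar) * dist v uStar ^ 2 : ℝ) : EReal))
    (hS : ∀ n, φ n (x n) ≤ S) (hx : Tendsto x atTop (𝓝 y)) :
    ∃ B, ∀ᶠ n in atTop, |(φ n (x n)).toReal| ≤ B := by
  have hlow : Tendsto (fun n => C - 1 / (2 * τStar) * dist (x n) uStar ^ 2) atTop
      (𝓝 (C - 1 / (2 * τStar) * dist y uStar ^ 2)) :=
    (((hx.dist tendsto_const_nhds).pow 2).const_mul _).const_sub C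
  set m : ℝ := C - 1 / (2 * τStar) * dist y uStar ^ 2
  refine ⟨max |m - 1| |S|, ?_⟩
  filter_upwards [hlow.eventually_const_le (sub_one_lt m)] with n hn
  have htop : φ n (x n) ≠ ⊤ := ne_top_of_le_ne_top (EReal.coe_ne_top S) (hS n)
  have hle := le_toReal_add_of_coe_le_add_coe (hC n (x n)) htop
  exact abs_le_max_abs_abs (by linarith)
    (EReal.toReal_le_toReal (hS n) (ne_bot_of_coe_le_add_coe (hC n (x n))) (EReal.coe_ne_top S))

end Convergence

section Compactness

variable {X : Type*} [MetricSpace X] {φε : ℝ → X → EReal} {φ : X → EReal} {ε τ : ℕ → ℝ}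
  {w : ℕ → ℕ → X} {v : ℕ → ℝ → X} {u : ℝ → X} {E V F : ℝ → ℝ} {T : ℝ}

theorem IsDeGiorgiInterpolation.isCurveOfMaximalSlope_of_tendsto (hH : ConditionH φε φ)
    (hε : ∀ n, 0 < ε n) (hε₀ : Tendsto ε atTop (𝓝 0)) (hτ : ∀ n, 0 < τ n)
    (hτ₀ : Tendsto τ atTop (𝓝 0)) (hbot : ∀ n x, φε (ε n) x ≠ ⊥)
    (h₀ : ∀ n, φε (ε n) (w n 0) ≠ ⊤)
    (hv : ∀ n, IsDeGiorgiInterpolation (φε (ε n)) (τ n) (w n) (v n))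
    (hu : ∀ t, 0 ≤ t → Tendsto (fun n => piecewiseConstant (τ n) (w n) t) atTop (𝓝 (u t)))
    (hE : ∀ t, Tendsto (fun n => (φε (ε n) (piecewiseConstant (τ n) (w n) t)).toReal) atTop
      (𝓝 (E t)))
    (hV : ∀ t, Tendsto (fun n => pathAction (τ n) (w n) ⌈t / τ n⌉₊) atTop (𝓝 (V t)))
    (hF : ∀ t, Tendsto (fun n => pathLength (w n) ⌈t / τ n⌉₊) atTop (𝓝 (F t))) (hT : 0 < T) :
    IsCurveOfMaximalSlope φ T u := by
  have hlim := HasDissipationBound.of_tendsto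
    (fun n => (hv n).hasDissipationBound (hτ n) (hbot n) (h₀ n)) hτ₀ hu hE hV hF
  have hident : ∀ᵐ t ∂(volume.restrict (Ioo 0 T)), φ (u t) = (E t : EReal) ∧
      descendingSlope φ (u t) ^ 2 ≤ liminf (fun n =>
        ENNReal.ofReal (-2 * deriv (deGiorgiEnergy (φε (ε n)) (τ n) (w n) (v n)) t)) atTop := by
    filter_upwards [hlim.ae_add_le_neg_deriv_energy hT, ae_restrict_mem measurableSet_Ioo,
      ae_restrict_of_ae (ae_differentiableAt_of_antitone hlim.antitone_energy),
      ae_restrict_of_ae (ae_all_iff.2 fun n =>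
        (hv n).ae_sq_descendingSlope_le (hτ n) (hbot n) (h₀ n))] with t hfin ht hEt hslope
    have hvu := tendsto_of_tendsto_piecewiseConstant hv hτ hτ₀ hbot h₀ ht.1 (hu t ht.1.le) (hV t)
    have hvE := tendsto_apply_of_tendsto_piecewiseConstant hv hτ hτ₀ hbot h₀ hE hEt.continuousAt
      ht.1
    exact hH.apply_eq_and_sq_descendingSlope_le hε hε₀ hvu hvE (fun n => hslope n ht.1) hfin.1
  exact hlim.isCurveOfMaximalSlope hT (hident.mono fun _ ht => ht.1) (hident.mono fun _ ht => ht.2)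

theorem IsDeGiorgiInterpolation.isCurveOfMaximalSlope {uStar : X} {C S τStar : ℝ}
    (hH : ConditionH φε φ) (hε : ∀ n, 0 < ε n) (hε₀ : Tendsto ε atTop (𝓝 0)) (hτ : ∀ n, 0 < τ n)
    (hτ₀ : Tendsto τ atTop (𝓝 0))
    (hC : ∀ n x, (C : EReal) ≤ φε (ε n) x + ((1 / (2 * τStar) * dist x uStar ^ 2 : ℝ) : EReal))
    (hS : ∀ n, φε (ε n) (w n 0) ≤ S)
    (hv : ∀ n, IsDeGiorgiInterpolation (φε (ε n)) (τ n) (w n) (v n))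
    (hu : ∀ t, 0 ≤ t → Tendsto (fun n => piecewiseConstant (τ n) (w n) t) atTop (𝓝 (u t)))
    (hT : 0 < T) : IsCurveOfMaximalSlope φ T u := by
  have hbot : ∀ n x, φε (ε n) x ≠ ⊥ := fun n x => ne_bot_of_coe_le_add_coe (hC n x)
  have h₀ : ∀ n, φε (ε n) (w n 0) ≠ ⊤ := fun n => ne_top_of_le_ne_top (EReal.coe_ne_top S) (hS n)
  have hu' : ∀ t, Tendsto (fun n => piecewiseConstant (τ n) (w n) t) atTop (𝓝 (u (max t 0))) := by
    intro t
    rcases le_total t 0 with ht | ht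
    · rw [max_eq_right ht]
      refine (hu 0 le_rfl).congr fun n => ?_
      simp only [piecewiseConstant, ceil_div_of_nonpos (hτ n) ht,
        ceil_div_of_nonpos (hτ n) le_rfl]
    · rw [max_eq_left ht]
      exact hu t ht
  obtain ⟨k, hk, E, V, F, hE, hV, hF⟩ := HasDissipationBound.exists_subseq_tendsto
    (fun n => (hv n).hasDissipationBound (hτ n) (hbot n) (h₀ n)) hτ₀ fun t =>
      exists_eventually_abs_toReal_le hC
        (fun n => ((hv n).antitone_apply_node (hτ n) (Nat.zero_le _)).trans (hS n)) (hu' t)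
  exact isCurveOfMaximalSlope_of_tendsto hH (fun n => hε (k n)) (hε₀.comp hk.tendsto_atTop)
    (fun n => hτ (k n)) (hτ₀.comp hk.tendsto_atTop) (fun n => hbot (k n)) (fun n => h₀ (k n))
    (fun n => hv (k n)) (fun t ht => (hu t ht).comp hk.tendsto_atTop) hE hV hF hT

end Compactness

theorem le_coe_max_zero_of_abs_le {x : EReal} {S : ℝ} (h : x.abs ≤ ENNReal.ofReal S) :
    x ≤ ((max S 0 : ℝ) : EReal) := by
  induction x with
  | bot => exact bot_le
  | top => simp at h
  | coe r =>
    have hr := h.trans (ENNReal.ofReal_le_ofReal (le_max_left S 0))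
    rw [EReal.abs_def, ENNReal.ofReal_le_ofReal_iff (le_max_right S 0)] at hr
    exact EReal.coe_le_coe_iff.2 ((le_abs_self r).trans hr)

theorem theorem1_general {X : Type*} [MetricSpace X] (φε : ℝ → X → EReal) (φ : X → EReal)
    (uStar : X) (h_i : ∀ ε > 0, LowerSemicontinuous (φε ε))
    (h_ii : ∃ C : ℝ, ∃ τStar > (0 : ℝ), ∀ ε > 0, ∀ v : X,
      (C : EReal) ≤ φε ε v + ((1 / (2 * τStar) * dist v uStar ^ 2 : ℝ) : EReal))
    (h_iii : ∀ ε > 0, ∀ C > (0 : ℝ), ∃ K : Set X, IsCompact K ∧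
      {u : X | dist u uStar ^ 2 ≤ C ∧ (φε ε u).abs ≤ ENNReal.ofReal C} ⊆ K)
    (h_H : ConditionH φε φ) (u₀ : ℝ → X) (h_u₀ : ∃ S : ℝ, ∀ ε > 0, φε ε (u₀ ε) ≤ S)
    (τ : ℝ → ℝ) (hτ_pos : ∀ ε > 0, 0 < τ ε) (hτ_lim : Tendsto τ (𝓝[>] 0) (𝓝 0))
    (u : ℝ → X) (hu : IsMinimizingMovement φε τ u₀ u) (T : ℝ) (hT : 0 < T) :
    IsCurveOfMaximalSlope φ T u := by
  obtain ⟨C, τStar, hτStar, hC⟩ := h_ii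
  obtain ⟨S, hS⟩ := h_u₀
  obtain ⟨w, hw, ε, hε, hε₀, hlim⟩ := hu
  have hε' : Tendsto ε atTop (𝓝[>] 0) :=
    tendsto_nhdsWithin_iff.2 ⟨hε₀, Eventually.of_forall hε⟩
  obtain ⟨k, hk, hkw⟩ := extraction_of_eventually_atTop ((hε'.eventually hw).and
    ((hτ_lim.comp hε').eventually_le_const (show 0 < τStar / 4 by positivity)))
  have hτk : ∀ n, 0 < τ (ε (k n)) := fun n => hτ_pos _ (hε _)
  have hSk : ∀ n, φε (ε (k n)) (w (ε (k n)) 0) ≤ S := fun n =>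
    (hkw n).1.1.symm ▸ hS _ (hε (k n))
  have hnode : ∀ n i, φε (ε (k n)) (w (ε (k n)) i) ≠ ⊤ := fun n i => by
    refine ne_top_of_le_ne_top (EReal.coe_ne_top S) (le_trans ?_ (hSk n))
    exact antitone_nat_of_succ_le (f := fun i => φε (ε (k n)) (w (ε (k n)) i))
      (fun i => IsProximal.le_self ((hkw n).1.2 i) (hτk n)) i.zero_le
  choose v hv using fun n => (hkw n).1.exists_isDeGiorgiInterpolation (hτk n) fun i σ hσ hστ =>
    exists_isProximal (h_i _ (hε _)) (hC _ (hε _)) (h_iii _ (hε _)) hσ (hστ.le.trans (hkw n).2)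
      (hnode n i)
  exact IsDeGiorgiInterpolation.isCurveOfMaximalSlope h_H (fun n => hε (k n))
    (hε₀.comp hk.tendsto_atTop) hτk ((hτ_lim.comp hε').comp hk.tendsto_atTop)
    (fun n => hC _ (hε _)) hSk hv (fun t ht => (hlim t ht).comp hk.tendsto_atTop) hT

theorem theorem1 {X : Type*} [MetricSpace X] [CompleteSpace X]
    (φε : ℝ → X → EReal) (φ : X → EReal)
    (hφε : ∀ ε > 0, ∀ x, φε ε x ≠ ⊥) (hφ : ∀ x, φ x ≠ ⊥)
    (uStar : X)
    (h_i : ∀ ε > 0, LowerSemicontinuous (φε ε))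
    (h_ii : ∃ C : ℝ, ∃ τStar > (0 : ℝ), ∀ ε > 0, ∀ v : X,
      (C : EReal) ≤ φε ε v + ((1 / (2 * τStar) * dist v uStar ^ 2 : ℝ) : EReal))
    (h_iii : ∀ C > (0 : ℝ), ∃ K : Set X, IsCompact K ∧ ∀ ε > 0,
      {u : X | dist u uStar ^ 2 ≤ C ∧ (φε ε u).abs ≤ ENNReal.ofReal C} ⊆ K)
    (h_H : ConditionH φε φ)
    (u₀ : ℝ → ℝ → X)
    (h_u₀ : ∃ S' S : ℝ, ∀ ε > 0, ∀ τ > 0,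
      dist (u₀ ε τ) uStar ^ 2 ≤ S' ∧ (φε ε (u₀ ε τ)).abs ≤ ENNReal.ofReal S)
    (τ : ℝ → ℝ) (hτ_pos : ∀ ε > 0, 0 < τ ε) (hτ_lim : Tendsto τ (𝓝[>] 0) (𝓝 0))
    (u : ℝ → X) (hu : IsMinimizingMovement φε τ (fun ε => u₀ ε (τ ε)) u)
    (T : ℝ) (hT : 0 < T) :
    IsCurveOfMaximalSlope φ T u := by
  obtain ⟨_, S, hS⟩ := h_u₀
  exact theorem1_general φε φ uStar h_i h_ii
    (fun ε hε C hC => (h_iii C hC).imp fun K hK => ⟨hK.1, hK.2 ε hε⟩) h_H (fun ε => u₀ ε (τ ε))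
    ⟨max S 0, fun ε hε => le_coe_max_zero_of_abs_le (hS ε hε _ (hτ_pos ε hε)).2⟩
    τ hτ_pos hτ_lim u hu T hT
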